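/- Let $\mathcal X$ be a measurable space with countably generated $\sigma$-algebra, $\mathrm dx$ a non-zero base measure on $\mathcal X$, $N,K\ge 0$ integers, and $U^0,\dots,U^N:\mathcal X\to\mathbb R$ measurable potentials with $Z_n=\int e^{-U^n(x)}\,\mathrm dx<\infty$. Let $\pi^n(\mathrm dx)=Z_n^{-1}e^{-U^n(x)}\,\mathrm dx$ and $\boldsymbol\pi=\pi^0\otimes\cdots\otimes\pi^N$. For $0\le n\le N$ let $K^n$ be a $\pi^n$-invariant Markov kernel on $\mathcal X$, with $K^0(x,\cdot)=\pi^0$ for all $x$. For $1\le n\le N$ and $1\le k\le K$ let $P^{n-1}_k$ and $Q^n_{k-1}$ be Markov kernels on $\mathcal X$, and define on $\mathcal X^{K+1}$ $$\mathbb P^{n-1}_K(\mathrm dx_{0:K})=\pi^{n-1}(\mathrm dx_0)\prod_{k=1}^K P^{n-1}_k(x_{k-1},\mathrm dx_k),\qquad \mathbb Q^{n}_K(\mathrm dx_{0:K})=\pi^{n}(\mathrm dx_K)\prod_{k=1}^K Q^{n}_{k-1}(x_{k},\mathrm dx_{k-1}).$$ Assume that $\mathbb P^{n-1}_K$ and $\mathbb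 Q^n_K$ are mutually absolutely continuous for every $n$, and put $$W^n_K=\log Z_{n-1}-\log Z_n-\log\frac{\mathrm d\mathbb Q^n_K}{\mathrm d\mathbb P^{n-1}_K},\qquad \alpha^n_K(x_{0:K},x'_{0:K})=\exp\bigl(\min\{0,W^n_K(x'_{0:K})-W^n_K(x_{0:K})\}\bigr).$$ The accelerated parallel tempering chain $\mathbf X_t=(X^0_t,\dots,X^N_t)$ is the (time-inhomogeneous) Markov chain on $\mathcal X^{N+1}$ whose iteration $t\ge1$, started from $\mathbf X_{t-1}$, is as follows. (1) Local exploration: independently for all $n$, replace $X^n$ by a sample from $K^n(X^n,\cdot)$. (2) Communication: for each $n\in\{1,\dots,N\}$ with $n\equiv t \pmod 2$, perform the $n$-th accelerated swap: given the current state, draw independently a forward path $\overrightarrow X_{0:K}$ with $\overrightarrow X_0=X^{n-1}$, $\overrightarrow X_k\sim P^{n-1}_k(\overrightarrow X_{k-1},\cdot)$, and a backward path $\overleftarrow X_{0:K}$ with $\overleftarrow X_K=X^n$, $\overleftarrow X_{k-1}\sim Q^n_{k-1}(\overleftarrow X_k,\cdot)$; with probability $\alpha^n_K(\overrightarrow X_{0:K},\overleftarrow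 X_{0:K})$ accept and replace $(X^{n-1},X^n)$ by $(\overleftarrow X_0,\overrightarrow X_K)$; otherwise reject and leave the state unchanged. The result is $\mathbf X_t$. Then: 1. The chain is ergodic: for $\boldsymbol\pi$-almost every initial state $\mathbf X_0=\mathbf x$, the law of $\mathbf X_t$ converges to $\boldsymbol\pi$ in total variation as $t\to\infty$. 2. The chain is $\boldsymbol\pi$-invariant: for every $t\ge1$, if $\mathbf X_{t-1}\sim\boldsymbol\pi$ then $\mathbf X_t\sim\boldsymbol\pi$. 3. For every $t\ge1$ and every $n\in\{1,\dots,N\}$ with $n\equiv t\pmod 2$, if $\mathbf X_{t-1}\sim\boldsymbol\pi$, then the probability that the $n$-th accelerated swap of iteration $t$ is rejected equals $$\bigl\|\mathbb P^{n-1}_K\otimes\mathbb Q^n_K-\mathbb Q^n_K\otimes\mathbb P^{n-1}_K\bigr\|_{\mathrm{TV}},$$ where $\|\mu-\nu\|_{\mathrm{TV}}=\sup_h|\int h\,\mathrm d\mu-\int h\,\mathrm d\nu|$ over measurable $h$ with values in $[0,1]$. -/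

import Mathlib

open MeasureTheory ProbabilityTheory

noncomputable section

/-- Total variation distance `sup_h |∫ h dμ - ∫ h dν|`, over measurable `h` with values in
`[0, 1]`. -/
def tvDist {Ω : Type*} [MeasurableSpace Ω] (μ ν : Measure Ω) : ℝ :=
  ⨆ h : {h : Ω → ℝ // Measurable h ∧ ∀ ω, h ω ∈ Set.Icc (0 : ℝ) 1},
    |∫ ω, h.1 ω ∂μ - ∫ ω, h.1 ω ∂ν|

/-- The law of the path `(x_0, …, x_K)` of the time-inhomogeneous Markov chain that starts at
`x_0 = x` and moves from `x_k` to `x_{k+1}` with the kernel `R k`. -/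
def pathKernel {X : Type*} [MeasurableSpace X] :
    (K : ℕ) → (Fin K → Kernel X X) → Kernel X (Fin (K + 1) → X)
  | 0, _ => Kernel.id.map (fun x _ => x)
  | K + 1, R =>
      (pathKernel K (fun k => R k.castSucc) ⊗ₖ
          Kernel.prodMkLeft X ((R (Fin.last K)).comap (fun p : Fin (K + 1) → X => p (Fin.last K))
            (measurable_pi_apply _))).map
        (fun q => (Fin.snoc q.1 q.2 : Fin (K + 2) → X))

/-- Measurability of the product of Markov kernels. -/
theorem measurable_pi_kernel {X : Type*} [MeasurableSpace X] {ι : Type*} [Fintype ι]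
    (κ : ι → Kernel X X) [∀ i, IsMarkovKernel (κ i)] :
    Measurable fun x : ι → X => Measure.pi fun i => κ i (x i) := by
  refine Measurable.measure_of_isPiSystem_of_isProbabilityMeasure
    (generateFrom_pi (α := fun _ : ι => X)).symm
    isPiSystem_pi ?_
  rintro s ⟨t, ht, rfl⟩
  simp only [Measure.pi_pi]
  refine Finset.measurable_fun_prod _ fun i _ => ?_
  exact ((κ i).measurable_coe (ht i (Set.mem_univ i))).comp (measurable_pi_apply i)

/-- The ingredients of accelerated parallel tempering with `N + 1` chains on the state space `X`
and `K` acceleration steps: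
* a base measure and the potentials `U^0, …, U^N`;
* the local exploration kernels `K^0, …, K^N`;
* `P i k` is the forward accelerator `P^{n-1}_{k+1}` (from `x_k` to `x_{k+1}`) and `Q i k` is the
  backward accelerator `Q^n_k` (from `x_{k+1}` to `x_k`) of the swap number `n = i + 1`. -/
structure APT (X : Type*) [MeasurableSpace X] (N K : ℕ) where
  base : Measure X
  U : Fin (N + 1) → X → ℝ
  explore : Fin (N + 1) → Kernel X X
  P : Fin N → Fin K → Kernel X X
  Q : Fin N → Fin K → Kernel X X
  markov_explore : ∀ n, IsMarkovKernel (explore n)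
  markov_P : ∀ i k, IsMarkovKernel (P i k)
  markov_Q : ∀ i k, IsMarkovKernel (Q i k)

namespace APT

attribute [instance] APT.markov_explore APT.markov_P APT.markov_Q

variable {X : Type*} [MeasurableSpace X] {N K : ℕ} (A : APT X N K)

/-- The normalising constant `Z_n = ∫ exp (-U^n(x)) dx`. -/
def Z (n : Fin (N + 1)) : ℝ := ∫ x, Real.exp (-A.U n x) ∂A.base

/-- The annealing distribution `π^n`, with density `exp (-U^n) / Z_n` w.r.t. the base measure. -/
def annealed (n : Fin (N + 1)) : Measure X := A.base.tilted fun x => -A.U n x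

/-- The joint distribution `π^0 ⊗ ⋯ ⊗ π^N`. -/
def target : Measure (Fin (N + 1) → X) := Measure.pi A.annealed

/-- Forward path `x_{0:K}` of the swap `n = i + 1`, given its start `x_0`. -/
def fwdPath (i : Fin N) : Kernel X (Fin (K + 1) → X) := pathKernel K (A.P i)

/-- Backward path `x_{0:K}` of the swap `n = i + 1`, given its start `x_K`: the chain that uses
successively `Q^n_{K-1}, …, Q^n_0`, read in reversed order. -/
def bwdPath (i : Fin N) : Kernel X (Fin (K + 1) → X) :=
  (pathKernel K fun k => A.Q i k.rev).map fun p k => p k.rev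

/-- The forward path law `ℙ^{n-1}_K`, `n = i + 1`. -/
def fwdLaw (i : Fin N) : Measure (Fin (K + 1) → X) := (A.annealed i.castSucc).bind (A.fwdPath i)

/-- The backward path law `ℚ^n_K`, `n = i + 1`. -/
def bwdLaw (i : Fin N) : Measure (Fin (K + 1) → X) := (A.annealed i.succ).bind (A.bwdPath i)

/-- The work `W^n_K = ΔF_n - log (dℚ^n_K / dℙ^{n-1}_K)`, where `ΔF_n = log Z_{n-1} - log Z_n` and
`n = i + 1`. -/
def work (i : Fin N) (p : Fin (K + 1) → X) : ℝ :=
  (Real.log (A.Z i.castSucc) - Real.log (A.Z i.succ)) -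
    Real.log ((A.bwdLaw i).rnDeriv (A.fwdLaw i) p).toReal

/-- Acceptance probability `α^n_K` of the swap `n = i + 1`, for the forward path `p` and the
backward path `q`. -/
def acceptProb (i : Fin N) (p q : Fin (K + 1) → X) : ℝ :=
  Real.exp (min 0 (A.work i q - A.work i p))

/-- Outcome of the swap `n = i + 1` for the state `x`, forward path `p`, backward path `q` and
uniform variable `u`: the new state, and whether the swap was accepted. -/
def swapUpdate (i : Fin N)
    (z : (Fin (N + 1) → X) × ((Fin (K + 1) → X) × (Fin (K + 1) → X)) × unitInterval) :
    (Fin (N + 1) → X) × Bool :=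
  if (z.2.2 : ℝ) < A.acceptProb i z.2.1.1 z.2.1.2 then
    (Function.update (Function.update z.1 i.castSucc (z.2.1.2 0)) i.succ
      (z.2.1.1 (Fin.last K)), true)
  else (z.1, false)

theorem measurable_swapUpdate (i : Fin N) : Measurable (A.swapUpdate i) := by
  have hw : Measurable (A.work i) := by
    unfold work
    exact measurable_const.sub (Measure.measurable_rnDeriv _ _).ennreal_toReal.log
  have ha : Measurable fun z : (Fin (N + 1) → X) ×
      ((Fin (K + 1) → X) × (Fin (K + 1) → X)) × unitInterval =>
      A.acceptProb i z.2.1.1 z.2.1.2 := by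
    unfold acceptProb
    fun_prop
  unfold swapUpdate
  refine Measurable.ite (measurableSet_lt (by fun_prop) ha) ?_ (by fun_prop)
  refine Measurable.prodMk ?_ measurable_const
  refine measurable_pi_iff.2 fun j => ?_
  simp only [Function.update_apply]
  split_ifs <;> fun_prop

/-- The accelerated swap move number `n = i + 1`, together with the information whether it was
accepted (`true`) or rejected (`false`). The forward path starts at `x^{n-1}`, the backward path
at `x^n`; the two paths and the uniform variable are independent given the state. -/
def swapWithFlag (i : Fin N) : Kernel (Fin (N + 1) → X) ((Fin (N + 1) → X) × Bool) :=
  (Kernel.id ×ₖ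
    (((A.fwdPath i).comap (fun x : Fin (N + 1) → X => x i.castSucc) (measurable_pi_apply _) ×ₖ
        (A.bwdPath i).comap (fun x : Fin (N + 1) → X => x i.succ) (measurable_pi_apply _)) ×ₖ
      Kernel.const _ (volume : Measure unitInterval))).map (A.swapUpdate i)

/-- The accelerated swap move number `n = i + 1`. -/
def swap (i : Fin N) : Kernel (Fin (N + 1) → X) (Fin (N + 1) → X) := (A.swapWithFlag i).fst

/-- The local exploration move: `x^n ~ K^n(x^n, ·)`, independently for `n = 0, …, N`. -/
def exploration : Kernel (Fin (N + 1) → X) (Fin (N + 1) → X) where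
  toFun x := Measure.pi fun n => A.explore n (x n)
  measurable' := measurable_pi_kernel A.explore

/-- The part of iteration `t` that consists of the local exploration move and of the accelerated
swap moves number `n ≤ m` with `n ≡ t mod 2`, in increasing order. -/
def stepUpTo (t : ℕ) : ℕ → Kernel (Fin (N + 1) → X) (Fin (N + 1) → X)
  | 0 => A.exploration
  | m + 1 =>
      if h : m < N ∧ m + 1 ≡ t [MOD 2] then A.swap ⟨m, h.1⟩ ∘ₖ stepUpTo t m
      else stepUpTo t m

/-- The transition kernel from `X_{t-1}` to `X_t`. -/
def step (t : ℕ) : Kernel (Fin (N + 1) → X) (Fin (N + 1) → X) := A.stepUpTo t N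

/-- The law of `X_t` given `X_0`. -/
def lawAt : ℕ → Kernel (Fin (N + 1) → X) (Fin (N + 1) → X)
  | 0 => Kernel.id
  | t + 1 => A.step (t + 1) ∘ₖ lawAt t

/-- The probability that the swap number `n = i + 1` is rejected in iteration `t`, when
`X_{t-1} ~ π^0 ⊗ ⋯ ⊗ π^N`. -/
def rejectionProb (t : ℕ) (i : Fin N) : ℝ :=
  ((A.target.bind (A.stepUpTo t i)).bind (A.swapWithFlag i)).real {z | z.2 = false}

end APT

end

/-!
Each of the two paths of a swap reveals the state it starts from, so under the product law a swap
resamples the pair of paths independently. Up to exchanging the two paths, it is then a Metropolis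
step with the deterministic proposal `Prod.swap`, whose acceptance ratio is the density of the
exchanged pair law. This gives invariance, and identifies the mean rejection probability with the
total variation distance between the pair law and its exchanged image.

For ergodicity, suppose that all swaps are accepted, which has positive probability. Every lineage
then visits chain `0`, where exploration forgets the past, within `2 * (N + 1)` iterations, so the
law after that many iterations dominates the target from every start. The steps are periodic in `t`
with period two, so the chain observed along multiples of `2 * (N + 1)` is time-homogeneous, with a
kernel `κ`. The limiting total variation distance between two copies started from `x` and `y` is
almost everywhere constant in `(x, y)`, and a one-step coupling of two laws with a common part shows
that this constant is zero. Monotonicity of total variation then covers all `t`.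
-/

noncomputable section

section TotalVariation

variable {Ω : Type*} [MeasurableSpace Ω]

theorem integrable_of_mem_Icc {μ : Measure Ω} [IsFiniteMeasure μ] {h : Ω → ℝ}
    (hm : Measurable h) (hI : ∀ ω, h ω ∈ Set.Icc (0 : ℝ) 1) : Integrable h μ :=
  .of_mem_Icc 0 1 hm.aemeasurable (ae_of_all _ hI)

theorem integral_mem_Icc {μ : Measure Ω} [IsFiniteMeasure μ] {h : Ω → ℝ}
    (hm : Measurable h) (hI : ∀ ω, h ω ∈ Set.Icc (0 : ℝ) 1) :
    ∫ ω, h ω ∂μ ∈ Set.Icc 0 (μ.real Set.univ) := by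
  refine ⟨integral_nonneg fun ω => (hI ω).1, ?_⟩
  calc ∫ ω, h ω ∂μ ≤ ∫ _, (1 : ℝ) ∂μ :=
        integral_mono (integrable_of_mem_Icc hm hI) (integrable_const _) fun ω => (hI ω).2
    _ = μ.real Set.univ := by simp

theorem tvDist_le {μ ν : Measure Ω} {c : ℝ}
    (hc : ∀ h : Ω → ℝ, Measurable h → (∀ ω, h ω ∈ Set.Icc (0 : ℝ) 1) →
      |∫ ω, h ω ∂μ - ∫ ω, h ω ∂ν| ≤ c) : tvDist μ ν ≤ c := by
  have : Nonempty {h : Ω → ℝ // Measurable h ∧ ∀ ω, h ω ∈ Set.Icc (0 : ℝ) 1} :=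
    ⟨⟨fun _ => 0, measurable_const, fun _ => by simp⟩⟩
  exact ciSup_le fun h => hc h.1 h.2.1 h.2.2

theorem abs_integral_sub_le_max {μ ν : Measure Ω} [IsFiniteMeasure μ] [IsFiniteMeasure ν]
    {h : Ω → ℝ} (hm : Measurable h) (hI : ∀ ω, h ω ∈ Set.Icc (0 : ℝ) 1) :
    |∫ ω, h ω ∂μ - ∫ ω, h ω ∂ν| ≤ max (μ.real Set.univ) (ν.real Set.univ) := by
  have hμ := integral_mem_Icc (μ := μ) hm hI
  have hν := integral_mem_Icc (μ := ν) hm hI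
  exact abs_sub_le_of_nonneg_of_le hμ.1 (hμ.2.trans (le_max_left _ _)) hν.1
    (hν.2.trans (le_max_right _ _))

theorem abs_integral_sub_le_tvDist {μ ν : Measure Ω} [IsFiniteMeasure μ] [IsFiniteMeasure ν]
    {h : Ω → ℝ} (hm : Measurable h) (hI : ∀ ω, h ω ∈ Set.Icc (0 : ℝ) 1) :
    |∫ ω, h ω ∂μ - ∫ ω, h ω ∂ν| ≤ tvDist μ ν := by
  refine le_ciSup (f := fun h : {h : Ω → ℝ // Measurable h ∧ ∀ ω, h ω ∈ Set.Icc (0 : ℝ) 1} =>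
    |∫ ω, h.1 ω ∂μ - ∫ ω, h.1 ω ∂ν|) ⟨max (μ.real Set.univ) (ν.real Set.univ), ?_⟩ ⟨h, hm, hI⟩
  rintro _ ⟨g, rfl⟩
  exact abs_integral_sub_le_max g.2.1 g.2.2

theorem tvDist_nonneg (μ ν : Measure Ω) : 0 ≤ tvDist μ ν :=
  Real.iSup_nonneg fun _ => abs_nonneg _

theorem tvDist_mem_Icc (μ ν : Measure Ω) [IsProbabilityMeasure μ] [IsProbabilityMeasure ν] :
    tvDist μ ν ∈ Set.Icc (0 : ℝ) 1 :=
  ⟨tvDist_nonneg μ ν, tvDist_le fun _ hm hI => by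
    simpa using abs_integral_sub_le_max (μ := μ) (ν := ν) hm hI⟩

theorem tvDist_self (μ : Measure Ω) : tvDist μ μ = 0 :=
  le_antisymm (tvDist_le fun _ _ _ => by rw [sub_self, abs_zero]) (tvDist_nonneg μ μ)

theorem tvDist_add_right (μ ν γ : Measure Ω) [IsFiniteMeasure μ] [IsFiniteMeasure ν]
    [IsFiniteMeasure γ] : tvDist (μ + γ) (ν + γ) = tvDist μ ν := by
  refine iSup_congr fun h => ?_
  rw [integral_add_measure (integrable_of_mem_Icc h.2.1 h.2.2) (integrable_of_mem_Icc h.2.1 h.2.2),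
    integral_add_measure (integrable_of_mem_Icc h.2.1 h.2.2) (integrable_of_mem_Icc h.2.1 h.2.2),
    add_sub_add_right_eq_sub]

theorem tvDist_eq_of_mutuallySingular {μ ν : Measure Ω} [IsFiniteMeasure μ] [IsFiniteMeasure ν]
    (hs : μ ⟂ₘ ν) (huniv : μ Set.univ = ν Set.univ) : tvDist μ ν = μ.real Set.univ := by
  have hreal : μ.real Set.univ = ν.real Set.univ := congrArg ENNReal.toReal huniv
  refine le_antisymm (tvDist_le fun h hm hI => ?_) ?_
  · simpa [← hreal] using abs_integral_sub_le_max (μ := μ) (ν := ν) hm hI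
  · obtain ⟨s, hsm, hμs, hνs⟩ := hs
    have hI : ∀ ω, sᶜ.indicator (fun _ => (1 : ℝ)) ω ∈ Set.Icc (0 : ℝ) 1 := fun ω => by
      by_cases hω : ω ∈ s <;> simp [hω]
    have hμ : μ.real sᶜ = μ.real Set.univ := by
      rw [measureReal_compl hsm, measureReal_def μ s, hμs, ENNReal.toReal_zero, sub_zero]
    have hν : ν.real sᶜ = 0 := by rw [measureReal_def, hνs, ENNReal.toReal_zero]
    have hle := abs_integral_sub_le_tvDist (μ := μ) (ν := ν)
      (measurable_const.indicator hsm.compl) hI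
    rw [integral_indicator_const _ hsm.compl, integral_indicator_const _ hsm.compl, hμ, hν,
      zero_smul, sub_zero, smul_eq_mul, mul_one] at hle
    exact (le_abs_self _).trans hle

theorem withDensity_tsub_mutuallySingular (ξ : Measure Ω) {u v : Ω → ENNReal} (hu : Measurable u)
    (hv : Measurable v) :
    ξ.withDensity (fun ω => u ω - v ω) ⟂ₘ ξ.withDensity fun ω => v ω - u ω := by
  have hs : MeasurableSet {ω | u ω ≤ v ω} := measurableSet_le hu hv
  refine ⟨_, hs, ?_, ?_⟩
  · rw [withDensity_apply _ hs]
    exact setLIntegral_eq_zero hs fun ω hω => tsub_eq_zero_of_le hω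
  · rw [withDensity_apply _ hs.compl]
    exact setLIntegral_eq_zero hs.compl fun ω hω => tsub_eq_zero_of_le (le_of_not_ge hω)

theorem withDensity_tsub_add_withDensity_min (ξ : Measure Ω) {u v : Ω → ENNReal}
    (hu : Measurable u) (hv : Measurable v) :
    (ξ.withDensity fun ω => u ω - v ω) + (ξ.withDensity fun ω => min (u ω) (v ω)) =
      ξ.withDensity u := by
  rw [← withDensity_add_left (f := fun ω => u ω - v ω) (hu.sub hv)]
  exact congrArg ξ.withDensity (funext fun ω => tsub_add_min)

theorem tvDist_withDensity {ξ : Measure Ω} {u v : Ω → ENNReal} (hu : Measurable u)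
    (hv : Measurable v) [IsFiniteMeasure (ξ.withDensity u)] [IsFiniteMeasure (ξ.withDensity v)]
    (huv : ξ.withDensity u Set.univ = ξ.withDensity v Set.univ) :
    tvDist (ξ.withDensity u) (ξ.withDensity v) = (∫⁻ ω, (u ω - v ω) ∂ξ).toReal := by
  set γ := ξ.withDensity fun ω => min (u ω) (v ω) with hγ
  set μ := ξ.withDensity fun ω => u ω - v ω
  set ν := ξ.withDensity fun ω => v ω - u ω
  have hμγ : μ + γ = ξ.withDensity u := withDensity_tsub_add_withDensity_min ξ hu hv
  have hνγ : ν + γ = ξ.withDensity v := by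
    simp_rw [hγ, min_comm (u _)]
    exact withDensity_tsub_add_withDensity_min ξ hv hu
  have : IsFiniteMeasure μ := isFiniteMeasure_of_le _ (hμγ ▸ Measure.le_add_right le_rfl)
  have : IsFiniteMeasure γ := isFiniteMeasure_of_le _ (hμγ ▸ Measure.le_add_left le_rfl)
  have : IsFiniteMeasure ν := isFiniteMeasure_of_le _ (hνγ ▸ Measure.le_add_right le_rfl)
  have huniv : μ Set.univ = ν Set.univ := by
    rw [← hμγ, ← hνγ, Measure.add_apply, Measure.add_apply] at huv
    exact (ENNReal.add_left_inj (measure_ne_top γ _)).1 huv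
  rw [← hμγ, ← hνγ, tvDist_add_right,
    tvDist_eq_of_mutuallySingular (withDensity_tsub_mutuallySingular ξ hu hv) huniv,
    measureReal_def, withDensity_apply _ MeasurableSet.univ, Measure.restrict_univ]

variable {α : Type*} [MeasurableSpace α]

theorem exists_measurable_eq_withDensity_add [MeasurableSpace.CountableOrCountablyGenerated α Ω]
    (κ η : Kernel α Ω) [IsFiniteKernel κ] [IsFiniteKernel η] :
    ∃ u v : α → Ω → ENNReal, Measurable (Function.uncurry u) ∧ Measurable (Function.uncurry v) ∧
      (∀ a, ((κ + η) a).withDensity (u a) = κ a) ∧ ∀ a, ((κ + η) a).withDensity (v a) = η a := by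
  have hd := Kernel.measurable_rnDerivAux κ (κ + η)
  have hu : Measurable (Function.uncurry fun a ω =>
      ((Kernel.rnDerivAux κ (κ + η) a ω).toNNReal : ENNReal)) := by
    unfold Function.uncurry; fun_prop
  have hv : Measurable (Function.uncurry fun a ω =>
      ((1 - Kernel.rnDerivAux κ (κ + η) a ω).toNNReal : ENNReal)) := by
    unfold Function.uncurry; fun_prop
  refine ⟨_, _, hu, hv, fun a => ?_, fun a => ?_⟩
  · rw [← Kernel.withDensity_apply _ hu, Kernel.withDensity_rnDerivAux κ η]
  · rw [← Kernel.withDensity_apply _ hv, Kernel.withDensity_one_sub_rnDerivAux κ η]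

theorem measurable_tvDist [MeasurableSpace.CountableOrCountablyGenerated α Ω]
    (κ η : Kernel α Ω) [IsMarkovKernel κ] [IsMarkovKernel η] :
    Measurable fun a => tvDist (κ a) (η a) := by
  obtain ⟨u, v, hu, hv, hκ, hη⟩ := exists_measurable_eq_withDensity_add κ η
  have key : ∀ a, tvDist (κ a) (η a) = (∫⁻ ω, (u a ω - v a ω) ∂((κ + η) a)).toReal := fun a => by
    have : IsProbabilityMeasure (((κ + η) a).withDensity (u a)) := by rw [hκ]; infer_instance
    have : IsProbabilityMeasure (((κ + η) a).withDensity (v a)) := by rw [hη]; infer_instance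
    rw [← hκ a, ← hη a]
    exact tvDist_withDensity (hu.comp measurable_prodMk_left) (hv.comp measurable_prodMk_left)
      (by rw [measure_univ, measure_univ])
  simp_rw [key]
  exact (Measurable.lintegral_kernel_prod_right (κ := κ + η) (f := fun a ω => u a ω - v a ω)
    (hu.sub hv)).ennreal_toReal

theorem measurable_integral_kernel (κ : Kernel α Ω) [IsMarkovKernel κ] {h : Ω → ℝ}
    (hm : Measurable h) : Measurable fun a => ∫ ω, h ω ∂κ a :=
  (hm.stronglyMeasurable.integral_kernel).measurable

theorem integral_kernel_mem_Icc (κ : Kernel α Ω) [IsMarkovKernel κ] {h : Ω → ℝ}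
    (hm : Measurable h) (hI : ∀ ω, h ω ∈ Set.Icc (0 : ℝ) 1) (a : α) :
    ∫ ω, h ω ∂κ a ∈ Set.Icc (0 : ℝ) 1 := by
  simpa using integral_mem_Icc (μ := κ a) hm hI

theorem integral_bind_kernel (μ : Measure α) [IsFiniteMeasure μ] (κ : Kernel α Ω)
    [IsMarkovKernel κ] {h : Ω → ℝ}
    (hm : Measurable h) (hI : ∀ ω, h ω ∈ Set.Icc (0 : ℝ) 1) :
    ∫ ω, h ω ∂(μ.bind κ) = ∫ a, ∫ ω, h ω ∂κ a ∂μ := by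
  have : IsFiniteMeasure ((κ ∘ₖ Kernel.const Unit μ) ()) := inferInstance
  rw [Measure.comp_eq_comp_const_apply, Kernel.integral_comp (integrable_of_mem_Icc hm hI),
    Kernel.const_apply]

theorem tvDist_bind_le (μ ν : Measure α) [IsFiniteMeasure μ] [IsFiniteMeasure ν]
    (κ : Kernel α Ω) [IsMarkovKernel κ] : tvDist (μ.bind κ) (ν.bind κ) ≤ tvDist μ ν := by
  refine tvDist_le fun h hm hI => ?_
  rw [integral_bind_kernel μ κ hm hI, integral_bind_kernel ν κ hm hI]
  exact abs_integral_sub_le_tvDist (measurable_integral_kernel κ hm)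
    (integral_kernel_mem_Icc κ hm hI)

theorem tvDist_fst_bind_snd_bind_le [MeasurableSpace.CountablyGenerated Ω]
    (Γ : Measure (α × α)) [IsFiniteMeasure Γ] (κ : Kernel α Ω) [IsMarkovKernel κ] :
    tvDist (Γ.fst.bind κ) (Γ.snd.bind κ) ≤ ∫ z, tvDist (κ z.1) (κ z.2) ∂Γ := by
  have hd : Measurable fun z : α × α => tvDist (κ z.1) (κ z.2) :=
    measurable_tvDist (κ.comap Prod.fst measurable_fst) (κ.comap Prod.snd measurable_snd)
  refine tvDist_le fun h hm hI => ?_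
  have hF := measurable_integral_kernel κ hm
  have hFI := integral_kernel_mem_Icc κ hm hI
  have h₁ : Integrable (fun z : α × α => ∫ ω, h ω ∂κ z.1) Γ :=
    integrable_of_mem_Icc (hF.comp measurable_fst) fun z => hFI z.1
  have h₂ : Integrable (fun z : α × α => ∫ ω, h ω ∂κ z.2) Γ :=
    integrable_of_mem_Icc (hF.comp measurable_snd) fun z => hFI z.2
  calc |∫ ω, h ω ∂(Γ.fst.bind κ) - ∫ ω, h ω ∂(Γ.snd.bind κ)|
      = |∫ z, (∫ ω, h ω ∂κ z.1 - ∫ ω, h ω ∂κ z.2) ∂Γ| := by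
        rw [integral_bind_kernel _ κ hm hI, integral_bind_kernel _ κ hm hI, Measure.fst,
          Measure.snd, integral_map measurable_fst.aemeasurable hF.aestronglyMeasurable,
          integral_map measurable_snd.aemeasurable hF.aestronglyMeasurable, integral_sub h₁ h₂]
    _ ≤ ∫ z, |∫ ω, h ω ∂κ z.1 - ∫ ω, h ω ∂κ z.2| ∂Γ := abs_integral_le_integral_abs
    _ ≤ ∫ z, tvDist (κ z.1) (κ z.2) ∂Γ :=
        integral_mono (h₁.sub h₂).abs (integrable_of_mem_Icc hd fun z => tvDist_mem_Icc _ _)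
          fun z => abs_integral_sub_le_tvDist hm hI

end TotalVariation

section Coupling

variable {α β γ δ : Type*} [MeasurableSpace α] [MeasurableSpace β] [MeasurableSpace γ]
  [MeasurableSpace δ]

theorem bind_prod_parallelComp (μ : Measure α) (ν : Measure β) [SFinite μ] [SFinite ν]
    (κ : Kernel α γ) (η : Kernel β δ) [IsSFiniteKernel κ] [IsSFiniteKernel η] :
    (μ.prod ν).bind (κ ∥ₖ η) = (μ.bind κ).prod (ν.bind η) := by
  rw [Measure.prod_comp_left, Measure.prod_comp_right, Measure.comp_assoc,
    Kernel.parallelComp_comp_parallelComp, Kernel.comp_id, Kernel.id_comp]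

theorem inv_measure_univ_smul_measure_univ_smul (μ : Measure α) [IsFiniteMeasure μ] :
    (μ Set.univ)⁻¹ • μ Set.univ • μ = μ := by
  rcases eq_or_ne (μ Set.univ) 0 with h | h
  · rw [Measure.measure_univ_eq_zero.1 h, smul_zero, smul_zero]
  · rw [smul_smul, ENNReal.inv_mul_cancel h (measure_ne_top μ _), one_smul]

theorem fst_inv_measure_univ_smul_prod {μ : Measure α} {ν : Measure β} [IsFiniteMeasure μ]
    [IsFiniteMeasure ν] (h : μ Set.univ = ν Set.univ) :
    ((μ Set.univ)⁻¹ • μ.prod ν).fst = μ := by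
  rw [Measure.fst, Measure.map_smul, Measure.map_fst_prod, ← h,
    inv_measure_univ_smul_measure_univ_smul]

theorem snd_inv_measure_univ_smul_prod {μ : Measure α} {ν : Measure β} [IsFiniteMeasure μ]
    [IsFiniteMeasure ν] (h : μ Set.univ = ν Set.univ) :
    ((μ Set.univ)⁻¹ • μ.prod ν).snd = ν := by
  rw [Measure.snd, Measure.map_smul, Measure.map_snd_prod, h,
    inv_measure_univ_smul_measure_univ_smul]

theorem inf_ne_zero_of_absolutelyContinuous {μ ν π : Measure α} [SigmaFinite μ] [SigmaFinite ν]
    (hπ : π ≠ 0) (hμ : π ≪ μ) (hν : π ≪ ν) : μ ⊓ ν ≠ 0 := fun h =>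
  hπ ((Measure.MutuallySingular.self_iff π).1
    ((Measure.mutuallySingular_iff_disjoint.2 (disjoint_iff.2 h)).mono_ac hμ hν))

-- The mass shared by `μ` and `ν` is coupled along the diagonal, the remainders independently.
theorem exists_coupling {μ ν : Measure α} [IsProbabilityMeasure μ] [IsProbabilityMeasure ν]
    (hne : μ ⊓ ν ≠ 0) :
    ∃ (ρ : Measure α) (θ : Measure (α × α)), IsFiniteMeasure ρ ∧ IsFiniteMeasure θ ∧
      (ρ.map (fun x => (x, x)) + θ).fst = μ ∧ (ρ.map (fun x => (x, x)) + θ).snd = ν ∧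
      θ ≪ μ.prod ν ∧ θ Set.univ < 1 := by
  set ρ := μ ⊓ ν
  have : IsFiniteMeasure ρ := isFiniteMeasure_of_le μ inf_le_left
  have hμ : ρ + (μ - ρ) = μ := by rw [add_comm, Measure.sub_add_cancel_of_le inf_le_left]
  have hν : ρ + (ν - ρ) = ν := by rw [add_comm, Measure.sub_add_cancel_of_le inf_le_right]
  have hμu : (μ - ρ) Set.univ = 1 - ρ Set.univ := by
    rw [Measure.sub_apply .univ inf_le_left, measure_univ]
  have hνu : (ν - ρ) Set.univ = 1 - ρ Set.univ := by
    rw [Measure.sub_apply .univ inf_le_right, measure_univ]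
  have huniv : (μ - ρ) Set.univ = (ν - ρ) Set.univ := hμu.trans hνu.symm
  have hlt : (μ - ρ) Set.univ < 1 := by
    rw [hμu]
    exact ENNReal.sub_lt_self ENNReal.one_ne_top one_ne_zero (Measure.measure_univ_ne_zero.2 hne)
  set θ := ((μ - ρ) Set.univ)⁻¹ • (μ - ρ).prod (ν - ρ)
  have hθ₁ : θ.fst = μ - ρ := fst_inv_measure_univ_smul_prod huniv
  have hθ₂ : θ.snd = ν - ρ := snd_inv_measure_univ_smul_prod huniv
  have hθu : θ Set.univ < 1 := by rwa [← Measure.fst_univ, hθ₁]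
  have hdiag : Measurable fun x : α => (x, x) := by fun_prop
  refine ⟨ρ, θ, inferInstance, ⟨hθu.trans ENNReal.one_lt_top⟩, ?_, ?_, ?_, hθu⟩
  · rw [Measure.fst_add, hθ₁, Measure.fst, Measure.map_map measurable_fst hdiag]
    exact (congrArg (· + _) Measure.map_id).trans hμ
  · rw [Measure.snd_add, hθ₂, Measure.snd, Measure.map_map measurable_snd hdiag]
    exact (congrArg (· + _) Measure.map_id).trans hν
  · exact (Measure.AbsolutelyContinuous.prod (Measure.absolutelyContinuous_of_le Measure.sub_le)
      (Measure.absolutelyContinuous_of_le Measure.sub_le)).smul_left _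

end Coupling

section Ergodic

variable {E : Type*} [MeasurableSpace E]

theorem ae_compProd_eq_of_le_integral {T : Kernel E E} [IsMarkovKernel T] {ρ : Measure E}
    [IsFiniteMeasure ρ] (hT : T.Invariant ρ) {g : E → ℝ} (hg : Measurable g)
    (hI : ∀ z, g z ∈ Set.Icc (0 : ℝ) 1) (hle : ∀ z, g z ≤ ∫ z', g z' ∂T z) :
    ∀ᵐ z ∂(ρ ⊗ₘ T), g z.1 = g z.2 := by
  have hsq : ∀ z, g z ^ 2 ∈ Set.Icc (0 : ℝ) 1 := fun z =>
    ⟨sq_nonneg _, pow_le_one₀ (hI z).1 (hI z).2⟩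
  have i₁ : Integrable (fun z : E × E => g z.1 ^ 2) (ρ ⊗ₘ T) :=
    integrable_of_mem_Icc (by fun_prop) fun z => hsq z.1
  have i₂ : Integrable (fun z : E × E => g z.2 ^ 2) (ρ ⊗ₘ T) :=
    integrable_of_mem_Icc (by fun_prop) fun z => hsq z.2
  have i₁₂ : Integrable (fun z : E × E => g z.1 * g z.2) (ρ ⊗ₘ T) :=
    integrable_of_mem_Icc (by fun_prop) fun z =>
      ⟨mul_nonneg (hI _).1 (hI _).1, mul_le_one₀ (hI _).2 (hI _).1 (hI _).2⟩
  have e₁ : ∫ z, g z.1 ^ 2 ∂(ρ ⊗ₘ T) = ∫ z, g z ^ 2 ∂ρ := by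
    conv_rhs => rw [← Measure.fst_compProd ρ T, Measure.fst]
    rw [integral_map measurable_fst.aemeasurable (by fun_prop)]
  have e₂ : ∫ z, g z.2 ^ 2 ∂(ρ ⊗ₘ T) = ∫ z, g z ^ 2 ∂ρ := by
    conv_rhs => rw [← hT.def, ← Measure.snd_compProd ρ T, Measure.snd]
    rw [integral_map measurable_snd.aemeasurable (by fun_prop)]
  have e₁₂ : ∫ z, g z ^ 2 ∂ρ ≤ ∫ z, g z.1 * g z.2 ∂(ρ ⊗ₘ T) := by
    have hTI := integral_kernel_mem_Icc T hg hI
    simp_rw [Measure.integral_compProd i₁₂, integral_const_mul, sq]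
    exact integral_mono (integrable_of_mem_Icc (hg.mul hg) fun z => by simpa only [sq] using hsq z)
      (integrable_of_mem_Icc (hg.mul (measurable_integral_kernel T hg)) fun z =>
        ⟨mul_nonneg (hI z).1 (hTI z).1, mul_le_one₀ (hI z).2 (hTI z).1 (hTI z).2⟩)
      fun z => mul_le_mul_of_nonneg_left (hle z) (hI z).1
  have i₃ : Integrable (fun z : E × E => g z.1 ^ 2 - 2 * (g z.1 * g z.2)) (ρ ⊗ₘ T) :=
    i₁.sub (i₁₂.const_mul 2)
  have hint : Integrable (fun z : E × E => (g z.1 - g z.2) ^ 2) (ρ ⊗ₘ T) := by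
    simp_rw [sub_sq, mul_assoc]
    exact i₃.add i₂
  have hzero : ∫ z, (g z.1 - g z.2) ^ 2 ∂(ρ ⊗ₘ T) = 0 := by
    refine le_antisymm ?_ (integral_nonneg fun z => sq_nonneg _)
    simp_rw [sub_sq, mul_assoc]
    rw [integral_add i₃ i₂, integral_sub i₁ (i₁₂.const_mul 2), integral_const_mul, e₁, e₂]
    linarith
  filter_upwards [(integral_eq_zero_iff_of_nonneg (fun z => sq_nonneg _) hint).1 hzero] with z hz
  exact sub_eq_zero.1 (pow_eq_zero_iff two_ne_zero |>.1 hz)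

theorem ae_eq_const_of_le_integral {T : Kernel E E} [IsMarkovKernel T] {ρ : Measure E}
    [IsProbabilityMeasure ρ] (hT : T.Invariant ρ) (hac : ∀ᵐ z ∂ρ, ρ ≪ T z) {g : E → ℝ}
    (hg : Measurable g) (hI : ∀ z, g z ∈ Set.Icc (0 : ℝ) 1) (hle : ∀ z, g z ≤ ∫ z', g z' ∂T z) :
    ∃ c, ∀ᵐ z ∂ρ, g z = c := by
  obtain ⟨z, hz, hzac⟩ :=
    ((Measure.ae_ae_of_ae_compProd (ae_compProd_eq_of_le_integral hT hg hI hle)).and hac).exists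
  have hzρ : ∀ᵐ z' ∂ρ, g z = g z' := hzac.ae_le hz
  exact ⟨g z, hzρ.mono fun _ h => h.symm⟩

instance isMarkovKernel_pow (κ : Kernel E E) [IsMarkovKernel κ] (t : ℕ) :
    IsMarkovKernel (κ ^ t) := by
  induction t with
  | zero => exact inferInstanceAs (IsMarkovKernel Kernel.id)
  | succ t ih => exact inferInstanceAs (IsMarkovKernel ((κ ^ t) ∘ₖ κ))

theorem pow_succ_apply_eq_bind (κ : Kernel E E) (t : ℕ) (x : E) :
    (κ ^ (t + 1)) x = (κ x).bind (κ ^ t) := by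
  rw [Kernel.pow_add, pow_one, Kernel.comp_apply]

theorem invariant_pow {κ : Kernel E E} {π : Measure E} (h : κ.Invariant π) (t : ℕ) :
    (κ ^ t).Invariant π := by
  induction t with
  | zero => exact Measure.id_comp
  | succ t ih => exact ih.comp h

/-- The limit, as `t → ∞`, of the total variation distance of the laws at time `t` of two copies
of the chain `κ` started at `z.1` and `z.2`. It is an infimum because the distance is nonincreasing
in `t`. -/
def tvDistLim (κ : Kernel E E) (z : E × E) : ℝ := ⨅ t, tvDist ((κ ^ t) z.1) ((κ ^ t) z.2)

section TvDistLim

variable (κ : Kernel E E)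

theorem bddBelow_range_tvDist_pow (z : E × E) :
    BddBelow (Set.range fun t => tvDist ((κ ^ t) z.1) ((κ ^ t) z.2)) :=
  ⟨0, Set.forall_mem_range.2 fun _ => tvDist_nonneg _ _⟩

theorem tvDistLim_self (x : E) : tvDistLim κ (x, x) = 0 := by
  simp only [tvDistLim, tvDist_self, ciInf_const]

variable [IsMarkovKernel κ]

theorem tendsto_tvDistLim (z : E × E) :
    Filter.Tendsto (fun t => tvDist ((κ ^ t) z.1) ((κ ^ t) z.2)) Filter.atTop
      (nhds (tvDistLim κ z)) := by
  refine tendsto_atTop_ciInf (antitone_nat_of_succ_le fun t => ?_) (bddBelow_range_tvDist_pow κ z)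
  rw [add_comm t 1, Kernel.pow_add, pow_one, Kernel.comp_apply, Kernel.comp_apply]
  exact tvDist_bind_le _ _ κ

theorem tvDistLim_mem_Icc (z : E × E) : tvDistLim κ z ∈ Set.Icc (0 : ℝ) 1 :=
  ⟨le_ciInf fun _ => tvDist_nonneg _ _,
    (ciInf_le (bddBelow_range_tvDist_pow κ z) 0).trans (tvDist_mem_Icc _ _).2⟩

variable [MeasurableSpace.CountablyGenerated E]

theorem measurable_tvDist_pow (t : ℕ) :
    Measurable fun z : E × E => tvDist ((κ ^ t) z.1) ((κ ^ t) z.2) :=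
  measurable_tvDist ((κ ^ t).comap Prod.fst measurable_fst) ((κ ^ t).comap Prod.snd measurable_snd)

theorem measurable_tvDistLim : Measurable (tvDistLim κ) :=
  measurable_of_tendsto_metrizable (measurable_tvDist_pow κ)
    (tendsto_pi_nhds.2 (tendsto_tvDistLim κ))

theorem tendsto_integral_tvDistLim (Γ : Measure (E × E)) [IsFiniteMeasure Γ] :
    Filter.Tendsto (fun t => ∫ z, tvDist ((κ ^ t) z.1) ((κ ^ t) z.2) ∂Γ) Filter.atTop
      (nhds (∫ z, tvDistLim κ z ∂Γ)) := by
  refine tendsto_integral_of_dominated_convergence (fun _ => 1)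
    (fun t => (measurable_tvDist_pow κ t).aestronglyMeasurable) (integrable_const _)
    (fun t => ae_of_all _ fun z => ?_) (ae_of_all _ (tendsto_tvDistLim κ))
  rw [Real.norm_eq_abs, abs_of_nonneg (tvDist_nonneg _ _)]
  exact (tvDist_mem_Icc _ _).2

theorem tvDistLim_le_integral_coupling {z : E × E} {Γ : Measure (E × E)} [IsFiniteMeasure Γ]
    (h₁ : Γ.fst = κ z.1) (h₂ : Γ.snd = κ z.2) : tvDistLim κ z ≤ ∫ z', tvDistLim κ z' ∂Γ := by
  refine ge_of_tendsto (tendsto_integral_tvDistLim κ Γ) (.of_forall fun t => ?_)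
  refine (ciInf_le (bddBelow_range_tvDist_pow κ z) (t + 1)).trans ?_
  rw [pow_succ_apply_eq_bind, pow_succ_apply_eq_bind, ← h₁, ← h₂]
  exact tvDist_fst_bind_snd_bind_le Γ (κ ^ t)

variable {κ}

-- A coupling of one step puts positive mass on the diagonal, where the limit vanishes, so the
-- limit would strictly decrease if it were a positive constant.
theorem tvDistLim_eq_zero_of_ae_eq {z : E × E} (hne : κ z.1 ⊓ κ z.2 ≠ 0)
    (hz : ∀ᵐ z' ∂(κ z.1).prod (κ z.2), tvDistLim κ z' = tvDistLim κ z) : tvDistLim κ z = 0 := by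
  obtain ⟨ρ, θ, _, _, h₁, h₂, hθ, hθu⟩ := exists_coupling hne
  have hdiag : Measurable fun x : E => (x, x) := by fun_prop
  have hint : ∀ (Γ : Measure (E × E)) [IsFiniteMeasure Γ], Integrable (tvDistLim κ) Γ := fun Γ _ =>
    integrable_of_mem_Icc (measurable_tvDistLim κ) (tvDistLim_mem_Icc κ)
  have hle : tvDistLim κ z ≤ θ.real Set.univ * tvDistLim κ z :=
    calc tvDistLim κ z ≤ ∫ z', tvDistLim κ z' ∂(ρ.map (fun x => (x, x)) + θ) :=
          tvDistLim_le_integral_coupling κ h₁ h₂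
      _ = ∫ x, tvDistLim κ (x, x) ∂ρ + ∫ z', tvDistLim κ z' ∂θ := by
          rw [integral_add_measure (hint _) (hint _),
            integral_map hdiag.aemeasurable (measurable_tvDistLim κ).aestronglyMeasurable]
      _ = θ.real Set.univ * tvDistLim κ z := by
          simp_rw [tvDistLim_self, integral_zero, zero_add]
          rw [integral_congr_ae (hθ.ae_le hz), integral_const, smul_eq_mul]
  have hlt : θ.real Set.univ < 1 := by
    simpa only [measureReal_def, ENNReal.toReal_one] using
      (ENNReal.toReal_lt_toReal (measure_ne_top θ _) ENNReal.one_ne_top).2 hθu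
  nlinarith [(tvDistLim_mem_Icc κ z).1]

theorem ae_tvDistLim_eq_zero {π : Measure E} [IsProbabilityMeasure π] (hinv : κ.Invariant π)
    (hac : ∀ᵐ x ∂π, π ≪ κ x) : ∀ᵐ z ∂π.prod π, tvDistLim κ z = 0 := by
  have hinv₂ : (κ ∥ₖ κ).Invariant (π.prod π) := by
    rw [Kernel.Invariant, bind_prod_parallelComp, hinv.def]
  have hac₂ : ∀ᵐ z ∂π.prod π, π ≪ κ z.1 ∧ π ≪ κ z.2 :=
    (Measure.quasiMeasurePreserving_fst.ae hac).and (Measure.quasiMeasurePreserving_snd.ae hac)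
  have hsub : ∀ z, tvDistLim κ z ≤ ∫ z', tvDistLim κ z' ∂(κ ∥ₖ κ) z := fun z => by
    rw [Kernel.parallelComp_apply]
    exact tvDistLim_le_integral_coupling κ Measure.fst_prod Measure.snd_prod
  obtain ⟨c, hc⟩ := ae_eq_const_of_le_integral hinv₂
    (hac₂.mono fun z hz => by rw [Kernel.parallelComp_apply]; exact hz.1.prod hz.2)
    (measurable_tvDistLim κ) (tvDistLim_mem_Icc κ) hsub
  have hstep : ∀ᵐ z ∂π.prod π, ∀ᵐ z' ∂(κ ∥ₖ κ) z, tvDistLim κ z' = c :=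
    Measure.ae_ae_of_ae_comp (by rwa [hinv₂.def])
  filter_upwards [hc, hstep, hac₂] with z hz hz' ⟨h₁, h₂⟩
  rw [Kernel.parallelComp_apply] at hz'
  exact tvDistLim_eq_zero_of_ae_eq
    (inf_ne_zero_of_absolutelyContinuous (IsProbabilityMeasure.ne_zero π) h₁ h₂)
    (by rwa [hz])

theorem ae_tendsto_tvDist_pow {π : Measure E} [IsProbabilityMeasure π] (hinv : κ.Invariant π)
    (hac : ∀ᵐ x ∂π, π ≪ κ x) :
    ∀ᵐ x ∂π, Filter.Tendsto (fun t => tvDist ((κ ^ t) x) π) Filter.atTop (nhds 0) := by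
  filter_upwards [Measure.ae_ae_of_ae_prod (ae_tvDistLim_eq_zero hinv hac)] with x hx
  have hzero : ∫ z, tvDistLim κ z ∂(Measure.dirac x).prod π = 0 := by
    rw [Measure.dirac_prod, integral_map (by fun_prop)
      (measurable_tvDistLim κ).aestronglyMeasurable, integral_congr_ae hx, integral_zero]
  refine squeeze_zero (fun t => tvDist_nonneg _ _) (fun t => ?_)
    (hzero ▸ tendsto_integral_tvDistLim κ ((Measure.dirac x).prod π))
  have h := tvDist_fst_bind_snd_bind_le ((Measure.dirac x).prod π) (κ ^ t)
  rwa [Measure.fst_prod, Measure.snd_prod, Measure.dirac_bind (κ ^ t).measurable,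
    (invariant_pow hinv t).def] at h

end TvDistLim

end Ergodic

section MetropolisHastings

variable {Ω : Type*} [MeasurableSpace Ω] {ξ : Measure Ω} {σ : Ω → Ω} {u a : Ω → ENNReal}

theorem map_withDensity_of_involutive (hσ : Function.Involutive σ) (hξ : MeasurePreserving σ ξ ξ)
    (hu : Measurable u) : (ξ.withDensity u).map σ = ξ.withDensity (u ∘ σ) := by
  ext s hs
  rw [Measure.map_apply hξ.measurable hs, withDensity_apply _ (hξ.measurable hs),
    withDensity_apply _ hs, ← hξ.setLIntegral_comp_preimage hs (hu.comp hξ.measurable)]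
  simp only [Function.comp_apply, hσ _]

theorem map_withDensity_withDensity_eq_self (hσ : Function.Involutive σ)
    (hξ : MeasurePreserving σ ξ ξ) (hu : Measurable u) (ha : Measurable a)
    (h : ∀ᵐ ω ∂ξ, u ω * a ω = min (u ω) (u (σ ω))) :
    ((ξ.withDensity u).withDensity a).map σ = (ξ.withDensity u).withDensity a := by
  have hmin : (ξ.withDensity u).withDensity a = ξ.withDensity fun ω => min (u ω) (u (σ ω)) := by
    rw [← withDensity_mul _ hu ha]
    exact withDensity_congr_ae h
  have hmeas : Measurable fun ω => min (u ω) (u (σ ω)) := hu.min (hu.comp hξ.measurable)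
  rw [hmin, map_withDensity_of_involutive hσ hξ hmeas]
  congr 1
  funext ω
  simp only [Function.comp_apply, hσ ω, min_comm]

theorem tvDist_map_withDensity (hσ : Function.Involutive σ) (hξ : MeasurePreserving σ ξ ξ)
    (hu : Measurable u) [IsFiniteMeasure (ξ.withDensity u)] (ha : Measurable a)
    (h : ∀ᵐ ω ∂ξ, u ω * a ω = min (u ω) (u (σ ω))) :
    tvDist (ξ.withDensity u) ((ξ.withDensity u).map σ) =
      (∫⁻ ω, (1 - a ω) ∂ξ.withDensity u).toReal := by
  have hmap := map_withDensity_of_involutive hσ hξ hu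
  have huσ := hu.comp hξ.measurable
  have : IsFiniteMeasure (ξ.withDensity (u ∘ σ)) := hmap ▸ inferInstance
  have ha' : Measurable fun ω => 1 - a ω := measurable_const.sub ha
  have huniv : ξ.withDensity u Set.univ = ξ.withDensity (u ∘ σ) Set.univ := by
    rw [← hmap, Measure.map_apply hξ.measurable .univ, Set.preimage_univ]
  have hfin : ∀ᵐ ω ∂ξ, u ω < ⊤ := by
    refine ae_lt_top hu ?_
    rw [← setLIntegral_univ, ← withDensity_apply _ .univ]
    exact measure_ne_top _ _
  rw [hmap, tvDist_withDensity hu huσ huniv, lintegral_withDensity_eq_lintegral_mul _ hu ha']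
  congr 1
  refine lintegral_congr_ae ?_
  filter_upwards [h, hfin] with ω hω hfin
  rw [Pi.mul_apply, ENNReal.mul_sub fun _ _ => hfin.ne, mul_one, hω, tsub_min, Function.comp_apply]

end MetropolisHastings

section ReadOff

variable {α β γ : Type*} [MeasurableSpace α] [MeasurableSpace β] [MeasurableSpace γ]

theorem compProd_prod_const (μ : Measure α) [SFinite μ] (κ : Kernel α β) [IsSFiniteKernel κ]
    (ν : Measure γ) [SFinite ν] :
    μ ⊗ₘ (κ ×ₖ Kernel.const α ν) = ((μ ⊗ₘ κ).prod ν).map fun z => (z.1.1, z.1.2, z.2) := by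
  refine Measure.ext_of_lintegral _ fun f hf => ?_
  rw [Measure.lintegral_compProd hf, lintegral_map hf (by fun_prop),
    lintegral_prod _ (by fun_prop), Measure.lintegral_compProd (by fun_prop)]
  refine lintegral_congr fun a => ?_
  rw [Kernel.prod_apply, Kernel.const_apply, lintegral_prod _ (by fun_prop)]

-- `B ×ˢ C` and `s ⁻¹' B ∩ C` have the same measure since `s ⁻¹' B` is null or conull.
theorem dirac_prod_eq_map {μ : Measure β} [IsProbabilityMeasure μ] {s : β → α} (hs : Measurable s)
    {a : α} (h : μ.map s = Measure.dirac a) :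
    (Measure.dirac a).prod μ = μ.map fun p => (s p, p) := by
  refine Measure.prod_eq fun B C hB hC => ?_
  have hB' : μ (s ⁻¹' B) = B.indicator 1 a := by
    rw [← Measure.map_apply hs hB, h, Measure.dirac_apply' _ hB]
  rw [Measure.map_apply (hs.prodMk measurable_id') (hB.prod hC), Measure.dirac_apply' _ hB,
    Set.mk_preimage_prod, Set.preimage_id']
  by_cases ha : a ∈ B
  · rw [Set.indicator_of_mem ha] at hB' ⊢
    rw [Pi.one_apply, one_mul, Set.inter_comm]
    exact measure_inter_conull ((prob_compl_eq_zero_iff (hs hB)).2 hB')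
  · rw [Set.indicator_of_notMem ha] at hB' ⊢
    rw [zero_mul]
    exact measure_mono_null Set.inter_subset_left hB'

theorem lintegral_eq_lintegral_of_map_eq_id {κ : Kernel α β} [IsMarkovKernel κ] {s : β → α}
    (hs : Measurable s) (hκ : κ.map s = Kernel.id) {f : α × β → ENNReal} (hf : Measurable f)
    (a : α) : ∫⁻ p, f (a, p) ∂κ a = ∫⁻ p, f (s p, p) ∂κ a := by
  have h : (κ a).map s = Measure.dirac a := by rw [← Kernel.map_apply _ hs, hκ, Kernel.id_apply]
  calc ∫⁻ p, f (a, p) ∂κ a = ∫⁻ z, f z ∂(Measure.dirac a).prod (κ a) := by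
        rw [Measure.dirac_prod, lintegral_map hf (by fun_prop)]
    _ = ∫⁻ p, f (s p, p) ∂κ a := by
        rw [dirac_prod_eq_map hs h, lintegral_map hf (by fun_prop)]

theorem lintegral_unitInterval_ite {c : ℝ} (hc : c ∈ Set.Icc (0 : ℝ) 1) (r₁ r₂ : ENNReal) :
    ∫⁻ w : unitInterval, (if (w : ℝ) < c then r₁ else r₂) =
      ENNReal.ofReal c * r₁ + (1 - ENNReal.ofReal c) * r₂ := by
  have hS : MeasurableSet {w : unitInterval | (w : ℝ) < c} :=
    measurableSet_lt (by fun_prop) measurable_const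
  have hv : volume {w : unitInterval | (w : ℝ) < c} = ENNReal.ofReal c :=
    unitInterval.volume_Iio ⟨c, hc⟩
  have hlt : ∫⁻ w : unitInterval in {w : unitInterval | (w : ℝ) < c},
      (if (w : ℝ) < c then r₁ else r₂) = r₁ * ENNReal.ofReal c := by
    rw [setLIntegral_congr_fun hS fun w (hw : (w : ℝ) < c) => if_pos hw, setLIntegral_const, hv]
  have hge : ∫⁻ w : unitInterval in {w : unitInterval | (w : ℝ) < c}ᶜ,
      (if (w : ℝ) < c then r₁ else r₂) = r₂ * (1 - ENNReal.ofReal c) := by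
    rw [setLIntegral_congr_fun hS.compl fun w (hw : ¬(w : ℝ) < c) => if_neg hw, setLIntegral_const,
      prob_compl_eq_one_sub hS, hv]
  rw [← lintegral_add_compl _ hS, hlt, hge, mul_comm, mul_comm r₂]

theorem map_ite_lt_prod_unitInterval (μ : Measure α) [SFinite μ] {c : α → ℝ} (hc : Measurable c)
    (hc₀₁ : ∀ z, c z ∈ Set.Icc (0 : ℝ) 1) {g h : α → β} (hg : Measurable g) (hh : Measurable h) :
    (μ.prod (volume : Measure unitInterval)).map
        (fun z => if (z.2 : ℝ) < c z.1 then g z.1 else h z.1) =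
      (μ.withDensity fun z => ENNReal.ofReal (c z)).map g +
        (μ.withDensity fun z => 1 - ENNReal.ofReal (c z)).map h := by
  have hmeas : Measurable fun z : α × unitInterval =>
      if (z.2 : ℝ) < c z.1 then g z.1 else h z.1 :=
    Measurable.ite (measurableSet_lt (by fun_prop) (by fun_prop)) (by fun_prop) (by fun_prop)
  refine Measure.ext_of_lintegral _ fun f hf => ?_
  have hfm : Measurable fun z : α × unitInterval =>
      f (if (z.2 : ℝ) < c z.1 then g z.1 else h z.1) := hf.comp hmeas
  have hfg : Measurable fun z => f (g z) := hf.comp hg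
  have hfh : Measurable fun z => f (h z) := hf.comp hh
  rw [lintegral_map hf hmeas, lintegral_prod _ hfm.aemeasurable, lintegral_add_measure,
    lintegral_map hf hg, lintegral_map hf hh,
    lintegral_withDensity_eq_lintegral_mul _ (by fun_prop) hfg,
    lintegral_withDensity_eq_lintegral_mul _ (by fun_prop) hfh, ← lintegral_add_left (by fun_prop)]
  refine lintegral_congr fun z => ?_
  simp_rw [apply_ite f]
  exact lintegral_unitInterval_ite (hc₀₁ z) _ _

end ReadOff

section Pi

theorem update_preimage_univ_pi {X ι : Type*} [DecidableEq ι] (i : ι) (s : ι → Set X) :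
    (fun z : (ι → X) × X => Function.update z.1 i z.2) ⁻¹' Set.univ.pi s =
      Set.univ.pi (Function.update s i Set.univ) ×ˢ s i := by
  ext z
  simp only [Set.mem_preimage, Set.mem_univ_pi, Set.mem_prod]
  rw [Function.forall_update_iff z.1 (p := fun n a => a ∈ s n),
    Function.forall_update_iff s (p := fun n t => z.1 n ∈ t), and_comm]
  simp only [Set.mem_univ, true_and]

variable {X : Type*} [MeasurableSpace X] {ι : Type*}

theorem countablyGenerated_pi [h : MeasurableSpace.CountablyGenerated X] [Countable ι] :
    MeasurableSpace.CountablyGenerated (ι → X) := by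
  obtain ⟨b, hb, hX⟩ := h.isCountablyGenerated
  refine ⟨⋃ i : ι, Set.preimage (fun x : ι → X => x i) '' b,
    Set.countable_iUnion fun i => hb.image _, ?_⟩
  rw [← MeasurableSpace.iSup_generateFrom]
  simp_rw [← MeasurableSpace.comap_generateFrom, ← hX]
  rfl

section Fintype

variable [Fintype ι]

theorem pi_dirac (x : ι → X) : Measure.pi (fun n => Measure.dirac (x n)) = Measure.dirac x := by
  refine Measure.pi_eq fun s hs => ?_
  simp_rw [Measure.dirac_apply' _ (MeasurableSet.univ_pi hs), Measure.dirac_apply' _ (hs _)]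
  by_cases h : x ∈ Set.univ.pi s
  · rw [Set.indicator_of_mem h, Pi.one_apply, Finset.prod_eq_one]
    intro n _
    rw [Set.indicator_of_mem (h n (Set.mem_univ n)), Pi.one_apply]
  · obtain ⟨n, hn⟩ : ∃ n, x n ∉ s n := by simpa using h
    rw [Set.indicator_of_notMem h]
    exact (Finset.prod_eq_zero (Finset.mem_univ n) (Set.indicator_of_notMem hn _)).symm

theorem lintegral_pi_prod (ν : ι → Measure X) [∀ n, IsProbabilityMeasure (ν n)]
    {f : ι → X → ENNReal} (hf : ∀ n, Measurable (f n)) :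
    ∫⁻ x, ∏ n, f n (x n) ∂Measure.pi ν = ∏ n, ∫⁻ a, f n a ∂ν n := by
  have hind : iIndepFun (fun n (x : ι → X) => f n (x n)) (Measure.pi ν) :=
    iIndepFun_pi fun n => (hf n).aemeasurable
  rw [lintegral_prod_eq_prod_lintegral_of_indepFun Finset.univ _ hind
    fun n => (hf n).comp (measurable_pi_apply n)]
  exact Finset.prod_congr rfl fun n _ => (measurePreserving_eval ν n).lintegral_comp (hf n)

end Fintype

section Update

variable [DecidableEq ι]

instance isProbabilityMeasure_update (ν : ι → Measure X) [∀ n, IsProbabilityMeasure (ν n)] (i : ι)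
    (μ : Measure X) [IsProbabilityMeasure μ] (n : ι) :
    IsProbabilityMeasure (Function.update ν i μ n) := by
  rcases eq_or_ne n i with rfl | h
  · rw [Function.update_self]; infer_instance
  · rw [Function.update_of_ne h]; infer_instance

/-- The family `y` with the entries at `i` and `j` replaced by the two components of `ab`; it is
applied to the states of two chains and to the laws of these states. -/
def updatePair {Y : Type*} (i j : ι) (y : ι → Y) (ab : Y × Y) : ι → Y :=
  Function.update (Function.update y i ab.1) j ab.2

theorem updatePair_eq_self {Y : Type*} (i j : ι) (y : ι → Y) : updatePair i j y (y i, y j) = y := by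
  rw [updatePair, Function.update_eq_self, Function.update_eq_self]

theorem updatePair_updatePair {Y : Type*} {i j : ι} (hij : i ≠ j) (y : ι → Y) (ab ab' : Y × Y) :
    updatePair i j (updatePair i j y ab) ab' = updatePair i j y ab' := by
  rw [updatePair, updatePair, Function.update_comm hij, Function.update_idem,
    Function.update_comm hij.symm, Function.update_idem, updatePair]

theorem updatePair_fst_snd {Y : Type*} {i j : ι} (hij : i ≠ j) (y : ι → Y) (ab : Y × Y) :
    (updatePair i j y ab i, updatePair i j y ab j) = ab := by
  rw [updatePair, Function.update_self, Function.update_of_ne hij, Function.update_self]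

theorem measurable_updatePair (i j : ι) :
    Measurable fun z : (ι → X) × X × X => updatePair i j z.1 z.2 :=
  measurable_update'.comp (f := fun z : (ι → X) × X × X => (Function.update z.1 i z.2.1, z.2.2))
    ((measurable_update'.comp (f := fun z : (ι → X) × X × X => (z.1, z.2.1)) (by fun_prop)).prodMk
      (by fun_prop))

instance isProbabilityMeasure_updatePair (ν : ι → Measure X) [∀ n, IsProbabilityMeasure (ν n)]
    (i j : ι) (μ₁ μ₂ : Measure X) [IsProbabilityMeasure μ₁] [IsProbabilityMeasure μ₂] (n : ι) :
    IsProbabilityMeasure (updatePair i j ν (μ₁, μ₂) n) :=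
  isProbabilityMeasure_update (Function.update ν i μ₁) j μ₂ n

variable [Fintype ι] (ν : ι → Measure X) [∀ n, IsProbabilityMeasure (ν n)]

theorem map_update_prod_pi (i : ι) (μ : Measure X) [IsProbabilityMeasure μ] :
    ((Measure.pi ν).prod μ).map (fun z : (ι → X) × X => Function.update z.1 i z.2) =
      Measure.pi (Function.update ν i μ) := by
  refine (Measure.pi_eq fun s hs => ?_).symm
  rw [Measure.map_apply measurable_update' (MeasurableSet.univ_pi hs), update_preimage_univ_pi,
    Measure.prod_prod, Measure.pi_pi, ← Finset.mul_prod_erase _ _ (Finset.mem_univ i),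
    ← Finset.mul_prod_erase (a := i) _ (fun n => Function.update ν i μ n (s n)) (Finset.mem_univ i),
    Function.update_self, Function.update_self, measure_univ, one_mul, mul_comm]
  congr 1
  refine Finset.prod_congr rfl fun n hn => ?_
  rw [Function.update_of_ne (Finset.ne_of_mem_erase hn),
    Function.update_of_ne (Finset.ne_of_mem_erase hn)]

theorem pi_update_absolutelyContinuous (i : ι) {μ : Measure X} [IsProbabilityMeasure μ]
    (h : μ ≪ ν i) : Measure.pi (Function.update ν i μ) ≪ Measure.pi ν := by
  conv_rhs => rw [← Function.update_eq_self i ν]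
  rw [← map_update_prod_pi, ← map_update_prod_pi]
  exact (Measure.AbsolutelyContinuous.rfl.prod h).map measurable_update'

theorem map_updatePair_prod_pi (i j : ι) (μ₁ μ₂ : Measure X) [IsProbabilityMeasure μ₁]
    [IsProbabilityMeasure μ₂] :
    ((Measure.pi ν).prod (μ₁.prod μ₂)).map (fun z => updatePair i j z.1 z.2) =
      Measure.pi (updatePair i j ν (μ₁, μ₂)) := by
  have hu : Measurable fun z : (ι → X) × X => Function.update z.1 i z.2 := measurable_update'
  rw [updatePair, ← map_update_prod_pi, ← map_update_prod_pi]
  conv_rhs => rw [← Measure.map_id (μ := μ₂)]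
  rw [Measure.map_prod_map _ _ hu measurable_id, Measure.map_map measurable_update'
    (hu.prodMap measurable_id), ← Measure.prodAssoc_prod,
    Measure.map_map (measurable_updatePair i j) (MeasurableEquiv.measurable _)]
  rfl

theorem lintegral_pi_eq_lintegral_updatePair (i j : ι) {g : (ι → X) → ENNReal}
    (hg : Measurable g) :
    ∫⁻ x, g x ∂Measure.pi ν =
      ∫⁻ y, ∫⁻ ab, g (updatePair i j y ab) ∂(ν i).prod (ν j) ∂Measure.pi ν := by
  have hgu : Measurable fun z : (ι → X) × X × X => g (updatePair i j z.1 z.2) :=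
    hg.comp (measurable_updatePair i j)
  conv_lhs => rw [← updatePair_eq_self i j ν, ← map_updatePair_prod_pi]
  rw [lintegral_map hg (measurable_updatePair i j), lintegral_prod _ hgu.aemeasurable]

-- The entries of `x` at `i` and `j` can be read off `r ~ κ (x i, x j)`, hence be resampled with it.
theorem pi_compProd_comap_pair {i j : ι} (hij : i ≠ j) {Ω : Type*} [MeasurableSpace Ω]
    {κ : Kernel (X × X) Ω} [IsMarkovKernel κ] {s : Ω → X × X} (hs : Measurable s)
    (hκ : κ.map s = Kernel.id) :
    Measure.pi ν ⊗ₘ κ.comap (fun x : ι → X => (x i, x j)) (by fun_prop) =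
      ((Measure.pi ν).prod (((ν i).prod (ν j)).bind κ)).map
        fun z => (updatePair i j z.1 (s z.2), z.2) := by
  have hu := measurable_updatePair (X := X) i j
  have hus : Measurable fun z : (ι → X) × Ω => (updatePair i j z.1 (s z.2), z.2) :=
    (hu.comp (f := fun z : (ι → X) × Ω => (z.1, s z.2)) (by fun_prop)).prodMk measurable_snd
  refine Measure.ext_of_lintegral _ fun f hf => ?_
  have hfu : Measurable fun z : (ι → X) × Ω => f (updatePair i j z.1 (s z.2), z.2) := hf.comp hus
  have hint : Measurable fun x : ι → X =>
      ∫⁻ r, f (x, r) ∂κ.comap (fun x => (x i, x j)) (by fun_prop) x :=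
    hf.lintegral_kernel_prod_right'
  rw [Measure.lintegral_compProd hf, lintegral_map hf hus,
    lintegral_prod _ hfu.aemeasurable]
  refine (lintegral_pi_eq_lintegral_updatePair ν i j hint).trans (lintegral_congr fun y => ?_)
  have hy : Measurable fun z : (X × X) × Ω => f (updatePair i j y z.1, z.2) :=
    hf.comp ((hu.comp (f := fun z : (X × X) × Ω => (y, z.1)) (by fun_prop)).prodMk measurable_snd)
  have hfy : Measurable fun r => f (updatePair i j y (s r), r) := hfu.comp measurable_prodMk_left
  rw [Measure.lintegral_bind κ.aemeasurable hfy.aemeasurable]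
  refine lintegral_congr fun ab => ?_
  rw [Kernel.comap_apply, updatePair_fst_snd hij]
  exact lintegral_eq_lintegral_of_map_eq_id hs hκ hy ab

end Update

theorem pi_absolutelyContinuous [Fintype ι] {μ ν : ι → Measure X}
    [∀ n, IsProbabilityMeasure (μ n)] [∀ n, IsProbabilityMeasure (ν n)] (h : ∀ n, μ n ≪ ν n) :
    Measure.pi μ ≪ Measure.pi ν := by
  classical
  have hpw : ∀ (s : Finset ι) n, IsProbabilityMeasure (s.piecewise μ ν n) := fun s n => by
    unfold Finset.piecewise
    split_ifs <;> infer_instance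
  suffices ∀ s : Finset ι, Measure.pi (s.piecewise μ ν) ≪ Measure.pi ν by
    simpa only [Finset.piecewise_univ] using this Finset.univ
  intro s
  induction s using Finset.induction_on with
  | empty => rw [Finset.piecewise_empty]
  | insert j s hj ih =>
    rw [Finset.piecewise_insert]
    refine (pi_update_absolutelyContinuous _ j ?_).trans ih
    rw [Finset.piecewise_eq_of_notMem _ _ _ hj]
    exact h j

end Pi

section PathKernel

variable {X : Type*} [MeasurableSpace X]

theorem measurable_snoc (K : ℕ) :
    Measurable fun q : (Fin (K + 1) → X) × X => (Fin.snoc q.1 q.2 : Fin (K + 2) → X) := by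
  refine measurable_pi_iff.2 fun k => ?_
  induction k using Fin.lastCases with
  | last => simpa only [Fin.snoc_last] using measurable_snd
  | cast k => simp only [Fin.snoc_castSucc]; fun_prop

instance isMarkovKernel_pathKernel : ∀ (K : ℕ) (R : Fin K → Kernel X X)
    [∀ k, IsMarkovKernel (R k)], IsMarkovKernel (pathKernel K R)
  | 0, _, _ => Kernel.IsMarkovKernel.map _ (by fun_prop)
  | K + 1, R, _ => by
      have := isMarkovKernel_pathKernel K fun k => R k.castSucc
      exact Kernel.IsMarkovKernel.map _ (measurable_snoc K)

theorem map_zero_pathKernel (K : ℕ) (R : Fin K → Kernel X X) [∀ k, IsMarkovKernel (R k)] :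
    (pathKernel K R).map (fun p => p 0) = Kernel.id := by
  induction K with
  | zero =>
    rw [pathKernel, ← Kernel.map_comp_right _ (by fun_prop) (by fun_prop)]
    exact Kernel.map_id _
  | succ K ih =>
    have hsnoc : (fun p : Fin (K + 2) → X => p 0) ∘
        (fun q : (Fin (K + 1) → X) × X => (Fin.snoc q.1 q.2 : Fin (K + 2) → X)) =
        (fun p => p 0) ∘ Prod.fst := by
      ext q
      exact Fin.snoc_castSucc (α := fun _ => X) q.2 q.1 0
    rw [pathKernel, ← Kernel.map_comp_right _ (measurable_snoc K) (by fun_prop), hsnoc,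
      Kernel.map_comp_right _ measurable_fst (by fun_prop), ← Kernel.fst_eq,
      Kernel.fst_compProd, ih]

end PathKernel

namespace APT

variable {X : Type*} [MeasurableSpace X] {N K : ℕ} (A : APT X N K)

section Markov

instance (i : Fin N) : IsMarkovKernel (A.fwdPath i) := isMarkovKernel_pathKernel K (A.P i)

instance (i : Fin N) : IsMarkovKernel (A.bwdPath i) :=
  Kernel.IsMarkovKernel.map _ (by fun_prop)

instance (i : Fin N) : IsMarkovKernel (A.swapWithFlag i) :=
  Kernel.IsMarkovKernel.map _ (A.measurable_swapUpdate i)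

instance (i : Fin N) : IsMarkovKernel (A.swap i) := by unfold swap; infer_instance

instance : IsMarkovKernel A.exploration :=
  ⟨fun x => inferInstanceAs (IsProbabilityMeasure (Measure.pi fun n => A.explore n (x n)))⟩

instance (t m : ℕ) : IsMarkovKernel (A.stepUpTo t m) := by
  induction m with
  | zero => rw [stepUpTo]; infer_instance
  | succ m ih => rw [stepUpTo]; split_ifs <;> infer_instance

instance (t : ℕ) : IsMarkovKernel (A.step t) := by unfold step; infer_instance

instance (t : ℕ) : IsMarkovKernel (A.lawAt t) := by
  induction t with
  | zero => rw [lawAt]; infer_instance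
  | succ t ih => rw [lawAt]; infer_instance

end Markov

theorem bind_exploration (ν : Fin (N + 1) → Measure X) [∀ n, IsProbabilityMeasure (ν n)] :
    (Measure.pi ν).bind A.exploration = Measure.pi fun n => (ν n).bind (A.explore n) := by
  refine (Measure.pi_eq fun s hs => ?_).symm
  have hbox : ∀ x : Fin (N + 1) → X,
      A.exploration x (Set.univ.pi s) = ∏ n, A.explore n (x n) (s n) := fun x =>
    Measure.pi_pi (fun n => A.explore n (x n)) s
  simp_rw [Measure.bind_apply (MeasurableSet.univ_pi hs) A.exploration.aemeasurable, hbox]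
  rw [lintegral_pi_prod ν fun n => (A.explore n).measurable_coe (hs n)]
  exact Finset.prod_congr rfl fun n _ =>
    (Measure.bind_apply (hs n) (A.explore n).aemeasurable).symm

section Swap

/-- The states `x^{n-1}` and `x^n` from which the forward path `r.1` and the backward path `r.2` of
the swap number `n` start. Those of `r.swap` are the states that an accepted swap produces. -/
def pathStarts (r : (Fin (K + 1) → X) × (Fin (K + 1) → X)) : X × X := (r.1 0, r.2 (Fin.last K))

theorem measurable_pathStarts : Measurable (pathStarts (X := X) (K := K)) := by
  unfold pathStarts; fun_prop

theorem map_fwdPath (i : Fin N) : (A.fwdPath i).map (fun p => p 0) = Kernel.id :=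
  map_zero_pathKernel K _

theorem map_bwdPath (i : Fin N) : (A.bwdPath i).map (fun p => p (Fin.last K)) = Kernel.id := by
  have hrev : (fun p : Fin (K + 1) → X => p (Fin.last K)) ∘
      (fun (p : Fin (K + 1) → X) k => p k.rev) = fun p => p 0 :=
    funext fun p => congrArg p (Fin.rev_last K)
  rw [bwdPath, ← Kernel.map_comp_right _ (by fun_prop) (by fun_prop), hrev, map_zero_pathKernel]

theorem map_bind_fwdPath (i : Fin N) (μ : Measure X) :
    (μ.bind (A.fwdPath i)).map (fun p => p 0) = μ := by
  rw [Measure.map_comp _ _ (by fun_prop), A.map_fwdPath, Measure.id_comp]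

theorem map_bind_bwdPath (i : Fin N) (μ : Measure X) :
    (μ.bind (A.bwdPath i)).map (fun p => p (Fin.last K)) = μ := by
  rw [Measure.map_comp _ _ (by fun_prop), A.map_bwdPath, Measure.id_comp]

theorem map_pathStarts_prod (μ ν : Measure (Fin (K + 1) → X)) [SFinite μ] [SFinite ν] :
    (μ.prod ν).map pathStarts = (μ.map fun p => p 0).prod (ν.map fun q => q (Fin.last K)) :=
  (Measure.map_prod_map μ ν (measurable_pi_apply 0) (measurable_pi_apply (Fin.last K))).symm

theorem map_pathStarts_fwdPath_parallelComp_bwdPath (i : Fin N) :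
    (A.fwdPath i ∥ₖ A.bwdPath i).map pathStarts = Kernel.id := by
  ext1 ab
  rw [Kernel.map_apply _ measurable_pathStarts, Kernel.parallelComp_apply, map_pathStarts_prod,
    ← Kernel.map_apply _ (by fun_prop), ← Kernel.map_apply _ (by fun_prop), A.map_fwdPath,
    A.map_bwdPath, Kernel.id_apply, Kernel.id_apply, Kernel.id_apply, Measure.dirac_prod_dirac]

theorem measurable_work (i : Fin N) : Measurable (A.work i) :=
  measurable_const.sub (Measure.measurable_rnDeriv _ _).ennreal_toReal.log

theorem measurable_acceptProb (i : Fin N) :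
    Measurable fun r : (Fin (K + 1) → X) × (Fin (K + 1) → X) => A.acceptProb i r.1 r.2 := by
  have := A.measurable_work i
  unfold acceptProb
  fun_prop

theorem acceptProb_mem_Icc (i : Fin N) (p q : Fin (K + 1) → X) :
    A.acceptProb i p q ∈ Set.Icc (0 : ℝ) 1 :=
  ⟨(Real.exp_pos _).le, Real.exp_le_one_iff.2 (min_le_left _ _)⟩

/-- The acceptance probability as a density on pairs of paths, which splits a law of pairs of paths
into its accepted and its rejected part. -/
def acceptDensity (i : Fin N) (r : (Fin (K + 1) → X) × (Fin (K + 1) → X)) : ENNReal :=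
  ENNReal.ofReal (A.acceptProb i r.1 r.2)

theorem measurable_acceptDensity (i : Fin N) : Measurable (A.acceptDensity i) :=
  (A.measurable_acceptProb i).ennreal_ofReal

theorem acceptDensity_ne_zero (i : Fin N) (r : (Fin (K + 1) → X) × (Fin (K + 1) → X)) :
    A.acceptDensity i r ≠ 0 :=
  (ENNReal.ofReal_pos.2 (Real.exp_pos _)).ne'

theorem acceptDensity_le_one (i : Fin N) (r : (Fin (K + 1) → X) × (Fin (K + 1) → X)) :
    A.acceptDensity i r ≤ 1 :=
  ENNReal.ofReal_le_one.2 (A.acceptProb_mem_Icc i _ _).2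

theorem withDensity_acceptDensity_add (i : Fin N)
    (R : Measure ((Fin (K + 1) → X) × (Fin (K + 1) → X))) :
    R.withDensity (A.acceptDensity i) + R.withDensity (fun r => 1 - A.acceptDensity i r) = R := by
  rw [← withDensity_add_left (A.measurable_acceptDensity i)]
  simp only [Pi.add_def, add_tsub_cancel_of_le (A.acceptDensity_le_one i _)]
  exact withDensity_one

/-- The state of the `N + 1` chains that agrees with `z.1` except that the states number `n - 1` and
`n = i + 1` are those from which the paths `z.2` start. -/
def stateOfPaths (i : Fin N) (z : (Fin (N + 1) → X) × (Fin (K + 1) → X) × (Fin (K + 1) → X)) :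
    Fin (N + 1) → X :=
  updatePair i.castSucc i.succ z.1 (pathStarts z.2)

theorem measurable_stateOfPaths (i : Fin N) :
    Measurable (stateOfPaths (X := X) (K := K) i) :=
  (measurable_updatePair i.castSucc i.succ).comp
    (measurable_fst.prodMk (measurable_pathStarts.comp measurable_snd))

theorem swapUpdate_stateOfPaths (i : Fin N)
    (z : (Fin (N + 1) → X) × (Fin (K + 1) → X) × (Fin (K + 1) → X)) (w : unitInterval) :
    A.swapUpdate i (stateOfPaths i z, z.2, w) =
      if (w : ℝ) < A.acceptProb i z.2.1 z.2.2 then (stateOfPaths i (z.1, z.2.swap), true)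
      else (stateOfPaths i z, false) := by
  rw [stateOfPaths, stateOfPaths, ← updatePair_updatePair Fin.castSucc_lt_succ.ne z.1
    (pathStarts z.2) (pathStarts z.2.swap)]
  rfl

theorem comap_fwdPath_prod_comap_bwdPath (i : Fin N) :
    (A.fwdPath i).comap (fun x : Fin (N + 1) → X => x i.castSucc) (measurable_pi_apply _) ×ₖ
        (A.bwdPath i).comap (fun x : Fin (N + 1) → X => x i.succ) (measurable_pi_apply _) =
      (A.fwdPath i ∥ₖ A.bwdPath i).comap (fun x => (x i.castSucc, x i.succ)) (by fun_prop) := by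
  ext1 x
  rw [Kernel.prod_apply, Kernel.comap_apply, Kernel.comap_apply, Kernel.comap_apply,
    Kernel.parallelComp_apply]

variable (ν : Fin (N + 1) → Measure X) [∀ n, IsProbabilityMeasure (ν n)]

/-- The law of the forward and backward paths of the swap number `n = i + 1`, when the states number
`n - 1` and `n` are independent with laws `ν (n - 1)` and `ν n`. -/
def pathsLaw (i : Fin N) : Measure ((Fin (K + 1) → X) × (Fin (K + 1) → X)) :=
  ((ν i.castSucc).bind (A.fwdPath i)).prod ((ν i.succ).bind (A.bwdPath i))

instance (i : Fin N) : IsProbabilityMeasure (A.pathsLaw ν i) := by unfold pathsLaw; infer_instance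

theorem map_pathStarts_pathsLaw (i : Fin N) :
    (A.pathsLaw ν i).map pathStarts = (ν i.castSucc).prod (ν i.succ) := by
  rw [pathsLaw, map_pathStarts_prod, map_bind_fwdPath, map_bind_bwdPath]

theorem pi_bind_swapWithFlag_eq_map_swapUpdate (i : Fin N) :
    (Measure.pi ν).bind (A.swapWithFlag i) =
      (((Measure.pi ν).prod (A.pathsLaw ν i)).prod (volume : Measure unitInterval)).map
        fun z => A.swapUpdate i (stateOfPaths i z.1, z.1.2, z.2) := by
  have hS := measurable_stateOfPaths (X := X) (K := K) i
  have hS' : Measurable fun z : (Fin (N + 1) → X) × (Fin (K + 1) → X) × (Fin (K + 1) → X) =>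
      (updatePair i.castSucc i.succ z.1 (pathStarts z.2), z.2) := hS.prodMk measurable_snd
  rw [swapWithFlag, ← Measure.map_comp _ _ (A.measurable_swapUpdate i),
    ← Measure.compProd_eq_comp_prod, compProd_prod_const, comap_fwdPath_prod_comap_bwdPath,
    pi_compProd_comap_pair ν Fin.castSucc_lt_succ.ne measurable_pathStarts
      (A.map_pathStarts_fwdPath_parallelComp_bwdPath i), bind_prod_parallelComp]
  conv_lhs => rw [← Measure.map_id (μ := (volume : Measure unitInterval))]
  rw [Measure.map_prod_map _ _ hS' measurable_id, Measure.map_map (by fun_prop)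
    (hS'.prodMap measurable_id), Measure.map_map (A.measurable_swapUpdate i)
    (Measurable.comp (by fun_prop) (hS'.prodMap measurable_id))]
  rfl

theorem pi_bind_swapWithFlag (i : Fin N) :
    (Measure.pi ν).bind (A.swapWithFlag i) =
      ((Measure.pi ν).prod
        (((A.pathsLaw ν i).withDensity (A.acceptDensity i)).map Prod.swap)).map
          (fun z => (stateOfPaths i z, true)) +
      ((Measure.pi ν).prod ((A.pathsLaw ν i).withDensity fun r => 1 - A.acceptDensity i r)).map
          fun z => (stateOfPaths i z, false) := by
  have hS := measurable_stateOfPaths (X := X) (K := K) i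
  have ha := A.measurable_acceptDensity i
  have hswap : Measurable (Prod.map id Prod.swap :
      (Fin (N + 1) → X) × (Fin (K + 1) → X) × (Fin (K + 1) → X) → _) :=
    measurable_id.prodMap measurable_swap
  rw [pi_bind_swapWithFlag_eq_map_swapUpdate]
  simp_rw [swapUpdate_stateOfPaths]
  refine (map_ite_lt_prod_unitInterval _ ((A.measurable_acceptProb i).comp measurable_snd)
    (fun z => A.acceptProb_mem_Icc i _ _) ((hS.comp hswap).prodMk measurable_const)
    (hS.prodMk measurable_const)).trans ?_
  have hproposal : (Measure.pi ν).prod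
      (((A.pathsLaw ν i).withDensity (A.acceptDensity i)).map Prod.swap) =
      (((Measure.pi ν).prod (A.pathsLaw ν i)).withDensity fun z => A.acceptDensity i z.2).map
        (Prod.map id Prod.swap) := by
    conv_lhs => rw [← Measure.map_id (μ := Measure.pi ν)]
    rw [Measure.map_prod_map _ _ measurable_id measurable_swap, prod_withDensity_right ha]
  have ha' : Measurable fun r => 1 - A.acceptDensity i r := measurable_const.sub ha
  rw [hproposal, prod_withDensity_right ha',
    Measure.map_map (hS.prodMk measurable_const) hswap]
  rfl

theorem pi_bind_swap (i : Fin N) :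
    (Measure.pi ν).bind (A.swap i) =
      ((Measure.pi ν).prod
        (((A.pathsLaw ν i).withDensity (A.acceptDensity i)).map Prod.swap +
          (A.pathsLaw ν i).withDensity fun r => 1 - A.acceptDensity i r)).map
        (stateOfPaths i) := by
  have hS := measurable_stateOfPaths (X := X) (K := K) i
  rw [swap, Kernel.fst_eq, ← Measure.map_comp _ _ measurable_fst, pi_bind_swapWithFlag,
    Measure.map_add _ _ measurable_fst, Measure.map_map measurable_fst (hS.prodMk measurable_const),
    Measure.map_map measurable_fst (hS.prodMk measurable_const), Measure.prod_add,
    Measure.map_add _ _ hS]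
  rfl

theorem map_stateOfPaths_prod (i : Fin N) (R : Measure ((Fin (K + 1) → X) × (Fin (K + 1) → X)))
    [SFinite R] :
    ((Measure.pi ν).prod R).map (stateOfPaths i) =
      ((Measure.pi ν).prod (R.map pathStarts)).map
        fun z => updatePair i.castSucc i.succ z.1 z.2 := by
  conv_rhs => rw [← Measure.map_id (μ := Measure.pi ν)]
  rw [Measure.map_prod_map _ _ measurable_id measurable_pathStarts,
    Measure.map_map (measurable_updatePair _ _) (measurable_id.prodMap measurable_pathStarts)]
  rfl

theorem map_stateOfPaths_pi_prod_pathsLaw (i : Fin N) :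
    ((Measure.pi ν).prod (A.pathsLaw ν i)).map (stateOfPaths i) = Measure.pi ν := by
  rw [map_stateOfPaths_prod, map_pathStarts_pathsLaw, map_updatePair_prod_pi, updatePair_eq_self]

end Swap

section Density

/-- The density `dℚ^n_K / dℙ^{n-1}_K`, `n = i + 1`, of the backward path law with respect to the
forward path law. -/
def pathDensity (i : Fin N) : (Fin (K + 1) → X) → ENNReal := (A.bwdLaw i).rnDeriv (A.fwdLaw i)

theorem measurable_pathDensity (i : Fin N) : Measurable (A.pathDensity i) :=
  Measure.measurable_rnDeriv _ _

theorem pathDensity_mul_acceptDensity_eq_min (i : Fin N)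
    {r : (Fin (K + 1) → X) × (Fin (K + 1) → X)}
    (h₁ : A.pathDensity i r.1 ≠ 0) (h₁' : A.pathDensity i r.1 ≠ ⊤)
    (h₂ : A.pathDensity i r.2 ≠ 0) (h₂' : A.pathDensity i r.2 ≠ ⊤) :
    A.pathDensity i r.2 * A.acceptDensity i r =
      min (A.pathDensity i r.2) (A.pathDensity i r.1) := by
  have hp : 0 < (A.pathDensity i r.1).toReal := ENNReal.toReal_pos h₁ h₁'
  have hq : 0 < (A.pathDensity i r.2).toReal := ENNReal.toReal_pos h₂ h₂'
  have hw : A.work i r.2 - A.work i r.1 =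
      Real.log (A.pathDensity i r.1).toReal - Real.log (A.pathDensity i r.2).toReal := by
    unfold work pathDensity; ring
  have ha : A.acceptProb i r.1 r.2 =
      min 1 ((A.pathDensity i r.1).toReal / (A.pathDensity i r.2).toReal) := by
    rw [acceptProb, hw, Real.exp_monotone.map_min, Real.exp_zero, Real.exp_sub, Real.exp_log hp,
      Real.exp_log hq]
  rw [← ENNReal.ofReal_toReal h₁', ← ENNReal.ofReal_toReal h₂', ← ENNReal.ofReal_min,
    acceptDensity, ← ENNReal.ofReal_mul hq.le, ha, mul_min_of_nonneg _ _ hq.le, mul_one,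
    mul_div_cancel₀ _ hq.ne']

variable [∀ n, IsProbabilityMeasure (A.annealed n)]

instance (i : Fin N) : IsProbabilityMeasure (A.fwdLaw i) := by unfold fwdLaw; infer_instance

instance (i : Fin N) : IsProbabilityMeasure (A.bwdLaw i) := by unfold bwdLaw; infer_instance

variable {A} {i : Fin N}

theorem ae_pathDensity_mul_acceptDensity (hac : A.fwdLaw i ≪ A.bwdLaw i) :
    ∀ᵐ r ∂(A.fwdLaw i).prod (A.fwdLaw i),
      A.pathDensity i r.2 * A.acceptDensity i r =
        min (A.pathDensity i r.2) (A.pathDensity i r.1) := by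
  have h : ∀ᵐ p ∂A.fwdLaw i, A.pathDensity i p ≠ 0 ∧ A.pathDensity i p ≠ ⊤ := by
    filter_upwards [Measure.rnDeriv_pos' hac, Measure.rnDeriv_lt_top (A.bwdLaw i) (A.fwdLaw i)]
      with p hp hp' using ⟨hp.ne', hp'.ne⟩
  filter_upwards [Measure.quasiMeasurePreserving_fst.ae h,
    Measure.quasiMeasurePreserving_snd.ae h] with r h₁ h₂
  exact A.pathDensity_mul_acceptDensity_eq_min i h₁.1 h₁.2 h₂.1 h₂.2

theorem fwdLaw_prod_bwdLaw (hac : A.bwdLaw i ≪ A.fwdLaw i) :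
    (A.fwdLaw i).prod (A.bwdLaw i) =
      ((A.fwdLaw i).prod (A.fwdLaw i)).withDensity fun r => A.pathDensity i r.2 := by
  conv_lhs => rw [← Measure.withDensity_rnDeriv_eq _ _ hac]
  exact prod_withDensity_right (A.measurable_pathDensity i)

-- Up to exchanging the two paths, the swap is a Metropolis step on pairs of paths, with proposal
-- `Prod.swap` and with stationary law `ℙ^{n-1}_K ⊗ ℚ^n_K`.
theorem map_swap_withDensity_acceptDensity
    (hac : A.fwdLaw i ≪ A.bwdLaw i ∧ A.bwdLaw i ≪ A.fwdLaw i) :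
    (((A.fwdLaw i).prod (A.bwdLaw i)).withDensity (A.acceptDensity i)).map Prod.swap =
      ((A.fwdLaw i).prod (A.bwdLaw i)).withDensity (A.acceptDensity i) := by
  rw [fwdLaw_prod_bwdLaw hac.2]
  exact map_withDensity_withDensity_eq_self Prod.swap_swap Measure.measurePreserving_swap
    ((A.measurable_pathDensity i).comp measurable_snd) (A.measurable_acceptDensity i)
    (ae_pathDensity_mul_acceptDensity hac.1)

theorem tvDist_fwdLaw_prod_bwdLaw (hac : A.fwdLaw i ≪ A.bwdLaw i ∧ A.bwdLaw i ≪ A.fwdLaw i) :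
    tvDist ((A.fwdLaw i).prod (A.bwdLaw i)) ((A.bwdLaw i).prod (A.fwdLaw i)) =
      (∫⁻ r, (1 - A.acceptDensity i r) ∂((A.fwdLaw i).prod (A.bwdLaw i))).toReal := by
  have hfin : IsFiniteMeasure (((A.fwdLaw i).prod (A.fwdLaw i)).withDensity
      fun r => A.pathDensity i r.2) := fwdLaw_prod_bwdLaw hac.2 ▸ inferInstance
  rw [← Measure.prod_swap (μ := A.fwdLaw i) (ν := A.bwdLaw i), fwdLaw_prod_bwdLaw hac.2]
  exact tvDist_map_withDensity Prod.swap_swap Measure.measurePreserving_swap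
    ((A.measurable_pathDensity i).comp measurable_snd) (A.measurable_acceptDensity i)
    (ae_pathDensity_mul_acceptDensity hac.1)

end Density

section Invariance

variable {A} [∀ n, IsProbabilityMeasure (A.annealed n)]

theorem swap_invariant {i : Fin N} (hac : A.fwdLaw i ≪ A.bwdLaw i ∧ A.bwdLaw i ≪ A.fwdLaw i) :
    (A.swap i).Invariant A.target := by
  have hR : A.pathsLaw A.annealed i = (A.fwdLaw i).prod (A.bwdLaw i) := rfl
  rw [Kernel.Invariant, target, pi_bind_swap, hR, map_swap_withDensity_acceptDensity hac, ← hR,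
    withDensity_acceptDensity_add, map_stateOfPaths_pi_prod_pathsLaw]

theorem exploration_invariant (hinv : ∀ n, (A.explore n).Invariant (A.annealed n)) :
    A.exploration.Invariant A.target := by
  rw [Kernel.Invariant, target, A.bind_exploration]
  exact congrArg Measure.pi (funext hinv)

variable (hinv : ∀ n, (A.explore n).Invariant (A.annealed n))
  (hac : ∀ i, A.fwdLaw i ≪ A.bwdLaw i ∧ A.bwdLaw i ≪ A.fwdLaw i)

include hinv hac

theorem stepUpTo_invariant (t m : ℕ) : (A.stepUpTo t m).Invariant A.target := by
  induction m with
  | zero => exact exploration_invariant hinv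
  | succ m ih =>
    rw [stepUpTo]
    split_ifs with h
    · exact (swap_invariant (hac _)).comp ih
    · exact ih

theorem lawAt_invariant (t : ℕ) : (A.lawAt t).Invariant A.target := by
  induction t with
  | zero => exact Measure.id_comp
  | succ t ih => exact (stepUpTo_invariant hinv hac _ _).comp ih

theorem rejectionProb_eq_tvDist (t : ℕ) (i : Fin N) :
    A.rejectionProb t i =
      tvDist ((A.fwdLaw i).prod (A.bwdLaw i)) ((A.bwdLaw i).prod (A.fwdLaw i)) := by
  have hS := measurable_stateOfPaths (X := X) (K := K) i
  have hB : MeasurableSet {z : (Fin (N + 1) → X) × Bool | z.2 = false} :=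
    measurable_snd (measurableSet_singleton false)
  have hacc : (fun z : (Fin (N + 1) → X) × (Fin (K + 1) → X) × (Fin (K + 1) → X) =>
      (stateOfPaths i z, true)) ⁻¹' {z | z.2 = false} = ∅ := by ext; simp
  have hrej : (fun z : (Fin (N + 1) → X) × (Fin (K + 1) → X) × (Fin (K + 1) → X) =>
      (stateOfPaths i z, false)) ⁻¹' {z | z.2 = false} = Set.univ := by ext; simp
  rw [tvDist_fwdLaw_prod_bwdLaw (hac i), rejectionProb, stepUpTo_invariant hinv hac, target,
    pi_bind_swapWithFlag, measureReal_def, Measure.add_apply,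
    Measure.map_apply (hS.prodMk measurable_const) hB,
    Measure.map_apply (hS.prodMk measurable_const) hB, hacc, hrej, measure_empty, zero_add,
    ← Set.univ_prod_univ, Measure.prod_prod, measure_univ, one_mul, withDensity_apply _ .univ,
    setLIntegral_univ]
  rfl

end Invariance

section Irreducibility

instance (i : Fin N) (ν : Measure X) [IsProbabilityMeasure ν] (k : Fin (K + 1)) :
    IsProbabilityMeasure ((ν.bind (A.fwdPath i)).map fun p => p k) :=
  Measure.isProbabilityMeasure_map (measurable_pi_apply k).aemeasurable

instance (i : Fin N) (ν : Measure X) [IsProbabilityMeasure ν] (k : Fin (K + 1)) :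
    IsProbabilityMeasure ((ν.bind (A.bwdPath i)).map fun q => q k) :=
  Measure.isProbabilityMeasure_map (measurable_pi_apply k).aemeasurable

theorem absolutelyContinuous_withDensity_acceptDensity (i : Fin N)
    (R : Measure ((Fin (K + 1) → X) × (Fin (K + 1) → X))) :
    R ≪ R.withDensity (A.acceptDensity i) :=
  withDensity_absolutelyContinuous' (A.measurable_acceptDensity i).aemeasurable
    (ae_of_all _ (A.acceptDensity_ne_zero i))

theorem pi_updatePair_absolutelyContinuous_bind_swap (i : Fin N) (ν : Fin (N + 1) → Measure X)
    [∀ n, IsProbabilityMeasure (ν n)] :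
    Measure.pi (updatePair i.castSucc i.succ ν
      (((ν i.succ).bind (A.bwdPath i)).map (fun q => q 0),
        ((ν i.castSucc).bind (A.fwdPath i)).map fun p => p (Fin.last K))) ≪
      (Measure.pi ν).bind (A.swap i) := by
  have hswap : (A.pathsLaw ν i).map Prod.swap =
      ((ν i.succ).bind (A.bwdPath i)).prod ((ν i.castSucc).bind (A.fwdPath i)) :=
    Measure.prod_swap
  rw [← map_updatePair_prod_pi, ← map_pathStarts_prod, ← hswap, ← map_stateOfPaths_prod,
    pi_bind_swap, Measure.prod_add, Measure.map_add _ _ (measurable_stateOfPaths i)]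
  have hacc := (A.absolutelyContinuous_withDensity_acceptDensity i (A.pathsLaw ν i)).map
    measurable_swap
  exact ((Measure.AbsolutelyContinuous.rfl.prod hacc).map (measurable_stateOfPaths i)).add_right _

/-- The measure `μ` dominates a product of probability distributions whose factors with index in `S`
dominate the annealing distributions. -/
def Dominates (μ : Measure (Fin (N + 1) → X)) (S : Set ℕ) : Prop :=
  ∃ ν : Fin (N + 1) → Measure X, (∀ n, IsProbabilityMeasure (ν n)) ∧
    (∀ n : Fin (N + 1), (n : ℕ) ∈ S → A.annealed n ≪ ν n) ∧ Measure.pi ν ≪ μ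

variable {A} {μ : Measure (Fin (N + 1) → X)} {S S' : Set ℕ}

theorem dominates_dirac_empty (x : Fin (N + 1) → X) : A.Dominates (Measure.dirac x) ∅ :=
  ⟨fun n => Measure.dirac (x n), fun _ => inferInstance, fun _ => False.elim,
    (pi_dirac x).absolutelyContinuous⟩

theorem Dominates.mono (h : A.Dominates μ S) (hS : ∀ n ≤ N, n ∈ S' → n ∈ S) :
    A.Dominates μ S' := by
  obtain ⟨ν, hprob, hdom, hpi⟩ := h
  exact ⟨ν, hprob, fun n hn => hdom n (hS n (Nat.lt_succ_iff.1 n.2) hn), hpi⟩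

theorem Dominates.target_absolutelyContinuous [∀ n, IsProbabilityMeasure (A.annealed n)]
    (h : A.Dominates μ S) (hS : ∀ n ≤ N, n ∈ S) : A.target ≪ μ := by
  obtain ⟨ν, hprob, hdom, hpi⟩ := h
  exact (pi_absolutelyContinuous fun n => hdom n (hS n (Nat.lt_succ_iff.1 n.2))).trans hpi

theorem Dominates.bind_exploration (h : A.Dominates μ S)
    (hinv : ∀ n, (A.explore n).Invariant (A.annealed n))
    (href : A.explore 0 = Kernel.const X (A.annealed 0)) :
    A.Dominates (μ.bind A.exploration) (insert 0 S) := by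
  obtain ⟨ν, hprob, hdom, hpi⟩ := h
  refine ⟨fun n => (ν n).bind (A.explore n), fun n => inferInstance, ?_, ?_⟩
  · rintro n (hn | hn)
    · obtain rfl : n = 0 := Fin.ext hn
      simp only [href, Measure.const_comp, measure_univ, one_smul]
      exact Measure.AbsolutelyContinuous.rfl
    · calc A.annealed n = (A.annealed n).bind (A.explore n) := (hinv n).symm
        _ ≪ (ν n).bind (A.explore n) := (hdom n hn).comp_right _
  · rw [← A.bind_exploration]
    exact hpi.comp_right _

theorem annealed_castSucc_absolutelyContinuous {i : Fin N} (hac : A.fwdLaw i ≪ A.bwdLaw i)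
    {ν : Measure X} (hν : A.annealed i.succ ≪ ν) :
    A.annealed i.castSucc ≪ (ν.bind (A.bwdPath i)).map fun q => q 0 := by
  rw [← A.map_bind_fwdPath i (A.annealed i.castSucc)]
  exact (hac.trans (hν.comp_right _)).map (by fun_prop)

theorem annealed_succ_absolutelyContinuous {i : Fin N} (hac : A.bwdLaw i ≪ A.fwdLaw i)
    {ν : Measure X} (hν : A.annealed i.castSucc ≪ ν) :
    A.annealed i.succ ≪ (ν.bind (A.fwdPath i)).map fun p => p (Fin.last K) := by
  rw [← A.map_bind_bwdPath i (A.annealed i.succ)]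
  exact (hac.trans (hν.comp_right _)).map (by fun_prop)

theorem Dominates.bind_swap (h : A.Dominates μ S) {i : Fin N}
    (hac : A.fwdLaw i ≪ A.bwdLaw i ∧ A.bwdLaw i ≪ A.fwdLaw i) :
    A.Dominates (μ.bind (A.swap i)) (Equiv.swap (i : ℕ) (i + 1) ⁻¹' S) := by
  obtain ⟨ν, hprob, hdom, hpi⟩ := h
  refine ⟨_, fun n => isProbabilityMeasure_updatePair ν i.castSucc i.succ _ _ n, fun n hn => ?_,
    (A.pi_updatePair_absolutelyContinuous_bind_swap i ν).trans (hpi.comp_right _)⟩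
  rw [Set.mem_preimage] at hn
  unfold updatePair
  by_cases hsucc : n = i.succ
  · subst hsucc
    rw [Fin.val_succ, Equiv.swap_apply_right] at hn
    rw [Function.update_self]
    exact annealed_succ_absolutelyContinuous hac.2 (hdom _ hn)
  by_cases hcast : n = i.castSucc
  · subst hcast
    rw [Fin.val_castSucc, Equiv.swap_apply_left] at hn
    rw [Function.update_of_ne hsucc, Function.update_self]
    exact annealed_castSucc_absolutelyContinuous hac.1 (hdom i.succ hn)
  have hfix : Equiv.swap (i : ℕ) (i + 1) n = n :=
    Equiv.swap_apply_of_ne_of_ne (fun h => hcast (Fin.ext h)) fun h => hsucc (Fin.ext h)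
  rw [hfix] at hn
  rw [Function.update_of_ne hsucc, Function.update_of_ne hcast]
  exact hdom n hn

/-- The position before the swaps number `k ≤ m`, `k ≡ t mod 2`, of the state that they move to the
position `n`, when all of them are accepted. -/
def swapSource (t m n : ℕ) : ℕ :=
  if n ≡ t [MOD 2] ∧ 1 ≤ n ∧ n ≤ m then n - 1
  else if n + 1 ≡ t [MOD 2] ∧ n + 1 ≤ m then n + 1
  else n

theorem swapSource_zero (t n : ℕ) : swapSource t 0 n = n := by
  unfold swapSource; split_ifs <;> omega

theorem swapSource_succ {t m : ℕ} (h : m + 1 ≡ t [MOD 2]) (n : ℕ) :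
    swapSource t (m + 1) n = swapSource t m (Equiv.swap m (m + 1) n) := by
  unfold swapSource Nat.ModEq at *
  rw [Equiv.swap_apply_def]
  grind

theorem swapSource_succ_of_not_modEq {t m : ℕ} (h : ¬m + 1 ≡ t [MOD 2]) (n : ℕ) :
    swapSource t (m + 1) n = swapSource t m n := by
  unfold swapSource Nat.ModEq at *
  grind

/-- The number of iterations since the state at the position `n` at time `t` was last at the
position `0`, when all swaps are accepted: it has climbed one position per iteration if `n ≡ t`,
and otherwise has climbed to `N`, waited there for one iteration, and descended to `n`. -/
def lineageAge (N t n : ℕ) : ℕ := if n ≡ t [MOD 2] then n else 2 * N + 1 - n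

theorem lineageAge_succ {N n : ℕ} (hn : n ≤ N) (t : ℕ) :
    swapSource (t + 1) N n = 0 ∨
      lineageAge N (t + 1) n = lineageAge N t (swapSource (t + 1) N n) + 1 := by
  unfold lineageAge swapSource Nat.ModEq
  grind

theorem lineageAge_lt {N n : ℕ} (hn : n ≤ N) (t : ℕ) : lineageAge N t n < 2 * (N + 1) := by
  unfold lineageAge; split_ifs <;> omega

variable (hinv : ∀ n, (A.explore n).Invariant (A.annealed n))
  (href : A.explore 0 = Kernel.const X (A.annealed 0))
  (hac : ∀ i, A.fwdLaw i ≪ A.bwdLaw i ∧ A.bwdLaw i ≪ A.fwdLaw i)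

include hinv href hac

theorem Dominates.bind_stepUpTo (h : A.Dominates μ S) (t : ℕ) {m : ℕ} (hm : m ≤ N) :
    A.Dominates (μ.bind (A.stepUpTo t m)) (swapSource t m ⁻¹' insert 0 S) := by
  induction m with
  | zero =>
    refine (h.bind_exploration hinv href).mono fun n _ hn => ?_
    rwa [Set.mem_preimage, swapSource_zero] at hn
  | succ m ih =>
    rw [stepUpTo]
    split_ifs with hs
    · rw [← Measure.comp_assoc]
      refine ((ih (by omega)).bind_swap (hac ⟨m, hs.1⟩)).mono fun n _ hn => ?_
      rwa [Set.mem_preimage, swapSource_succ hs.2] at hn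
    · refine (ih (by omega)).mono fun n _ hn => ?_
      rwa [Set.mem_preimage, swapSource_succ_of_not_modEq fun h => hs ⟨hm, h⟩] at hn

theorem dominates_lawAt (x : Fin (N + 1) → X) (t : ℕ) :
    A.Dominates (A.lawAt t x) {n | lineageAge N t n < t} := by
  induction t with
  | zero =>
    rw [lawAt, Kernel.id_apply]
    exact (dominates_dirac_empty x).mono fun n _ hn => absurd hn (Nat.not_lt_zero _)
  | succ t ih =>
    rw [lawAt, Kernel.comp_apply]
    refine (ih.bind_stepUpTo hinv href hac (t + 1) le_rfl).mono fun n hn hage => ?_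
    refine (lineageAge_succ hn t).imp_right fun hsource => ?_
    rw [Set.mem_ofPred_eq, hsource] at hage
    exact Nat.lt_of_succ_lt_succ hage

theorem target_absolutelyContinuous_lawAt [∀ n, IsProbabilityMeasure (A.annealed n)]
    (x : Fin (N + 1) → X) : A.target ≪ A.lawAt (2 * (N + 1)) x :=
  (dominates_lawAt hinv href hac x _).target_absolutelyContinuous fun _ hn => lineageAge_lt hn _

end Irreducibility

section Convergence

theorem stepUpTo_add_two_mul (t s m : ℕ) : A.stepUpTo (t + 2 * s) m = A.stepUpTo t m := by
  induction m with
  | zero => rfl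
  | succ m ih =>
    have h : m + 1 ≡ t + 2 * s [MOD 2] ↔ m + 1 ≡ t [MOD 2] := by
      unfold Nat.ModEq; omega
    simp only [stepUpTo, ih, h]

theorem lawAt_add_two_mul (t s : ℕ) : A.lawAt (t + 2 * s) = A.lawAt t ∘ₖ A.lawAt (2 * s) := by
  induction t with
  | zero => rw [zero_add, lawAt, Kernel.id_comp]
  | succ t ih =>
    rw [show t + 1 + 2 * s = (t + 2 * s) + 1 by ring, lawAt, lawAt, ih, Kernel.comp_assoc, step,
      step, show t + 2 * s + 1 = t + 1 + 2 * s by ring, stepUpTo_add_two_mul]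

theorem lawAt_two_mul_mul (s q : ℕ) : A.lawAt (2 * s * q) = A.lawAt (2 * s) ^ q := by
  induction q with
  | zero => rfl
  | succ q ih => rw [pow_succ, ← ih, mul_add_one, lawAt_add_two_mul]; rfl

variable {A} [∀ n, IsProbabilityMeasure (A.annealed n)]
  (hinv : ∀ n, (A.explore n).Invariant (A.annealed n))
  (hac : ∀ i, A.fwdLaw i ≪ A.bwdLaw i ∧ A.bwdLaw i ≪ A.fwdLaw i)

include hinv hac

theorem antitone_tvDist_lawAt (x : Fin (N + 1) → X) :
    Antitone fun t => tvDist (A.lawAt t x) A.target := by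
  have : IsProbabilityMeasure A.target := by unfold target; infer_instance
  refine antitone_nat_of_succ_le fun t => ?_
  have hstep : A.target.bind (A.step (t + 1)) = A.target := stepUpTo_invariant hinv hac _ _
  calc tvDist (A.lawAt (t + 1) x) A.target
      = tvDist ((A.lawAt t x).bind (A.step (t + 1))) (A.target.bind (A.step (t + 1))) := by
        rw [lawAt, Kernel.comp_apply, hstep]
    _ ≤ tvDist (A.lawAt t x) A.target := tvDist_bind_le _ _ _

theorem ae_tendsto_tvDist_lawAt [MeasurableSpace.CountablyGenerated X]
    (href : A.explore 0 = Kernel.const X (A.annealed 0)) :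
    ∀ᵐ x ∂A.target,
      Filter.Tendsto (fun t => tvDist (A.lawAt t x) A.target) Filter.atTop (nhds 0) := by
  have : MeasurableSpace.CountablyGenerated (Fin (N + 1) → X) := countablyGenerated_pi
  have : IsProbabilityMeasure A.target := by unfold target; infer_instance
  filter_upwards [ae_tendsto_tvDist_pow (lawAt_invariant hinv hac (2 * (N + 1)))
    (ae_of_all _ (target_absolutelyContinuous_lawAt hinv href hac))] with x hx
  simp_rw [← lawAt_two_mul_mul] at hx
  exact (tendsto_iff_tendsto_subseq_of_antitone (antitone_tvDist_lawAt hinv hac x)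
    (Filter.tendsto_id.const_mul_atTop' (by omega))).2 hx

end Convergence

end APT

end

theorem theorem1 {X : Type*} [MeasurableSpace X] [MeasurableSpace.CountablyGenerated X]
    {N K : ℕ} (A : APT X N K)
    (hbase : A.base ≠ 0)
    (hU : ∀ n, Measurable (A.U n))
    (hZ : ∀ n, Integrable (fun x => Real.exp (-A.U n x)) A.base)
    (hinv : ∀ n, (A.explore n).Invariant (A.annealed n))
    (href : A.explore 0 = Kernel.const X (A.annealed 0))
    (hac : ∀ i, A.fwdLaw i ≪ A.bwdLaw i ∧ A.bwdLaw i ≪ A.fwdLaw i) :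
    (∀ᵐ x ∂A.target,
        Filter.Tendsto (fun t => tvDist (A.lawAt t x) A.target) Filter.atTop (nhds 0)) ∧
      (∀ t, 1 ≤ t → (A.step t).Invariant A.target) ∧
      (∀ (t : ℕ) (i : Fin N), 1 ≤ t → (i : ℕ) + 1 ≡ t [MOD 2] →
        A.rejectionProb t i =
          tvDist ((A.fwdLaw i).prod (A.bwdLaw i)) ((A.bwdLaw i).prod (A.fwdLaw i))) := by
  have : NeZero A.base := ⟨hbase⟩
  have hprob : ∀ n, IsProbabilityMeasure (A.annealed n) := fun n =>
    isProbabilityMeasure_tilted (hZ n)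
  exact ⟨APT.ae_tendsto_tvDist_lawAt hinv hac href,
    fun t _ => APT.stepUpTo_invariant hinv hac t N,
    fun t i _ _ => APT.rejectionProb_eq_tvDist hinv hac t i⟩
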